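/- Let $k$ be a field, let $n\ge 1$, and let $\Pi=\Pi_{A_n}$ be the preprojective algebra of type $A_n$ over $k$, that is, the path algebra $k\overline Q$ of the double quiver $\overline Q$ of $Q\colon 1\to 2\to\cdots\to n$ (each arrow $a$ of $Q$ gets a reversed arrow $a^*$) modulo the two-sided ideal generated by $\sum_{a\in Q_1}(aa^*-a^*a)$. Let $I_{\mathrm{cyc}}$ be the two-sided ideal of $\Pi$ generated by all 2-cycles of $\overline Q$, and let $\overline\Pi=\Pi/I_{\mathrm{cyc}}$. For a finite-dimensional $k$-algebra $A$, let $\mathrm{Ideals}\,A$ be the lattice of two-sided ideals of $A$ ordered by inclusion, $\mathrm{mod}\,A$ the category of finitely generated left $A$-modules, and $\mathrm{tors}\,A$ the complete lattice, ordered by inclusion, of torsion classes of $\mathrm{mod}\,A$ (classes that contain $0$ and are closed under isomorphisms, factor modules and extensions). For $I\in\mathrm{Ideals}\,A$, let $\eta_A(I)$ be the complete lattice congruence on $\mathrm{tors}\,A$ for which $\mathcal T\equiv\mathcal U$ if and only if $\mathcal T\cap\mathrm{mod}(A/I)=\mathcal U\cap\mathrm{mod}(A/I)$, where $\mathrm{mod}(A/I)$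 is identified with the class of the modules in $\mathrm{mod}\,A$ that are annihilated by $I$. Let $\mathrm{AlgCon}\,A$ be the image of $\eta_A$, ordered by refinement. A brick is a module in $\mathrm{mod}\,A$ whose endomorphism ring is a division ring. Let $\mathscr U$ be the set of paths of $\overline Q$, trivial paths included, that visit each vertex at most once, partially ordered by $w\le w'$ if $w$ is a subpath of $w'$; elements of $\mathscr U$ are also regarded as elements of $\Pi$ and of $\overline\Pi$. Let $\mathrm{Ideals}\,\mathscr U$ be the set, ordered by inclusion, of the subsets $\mathcal S\subseteq\mathscr U$ such that $w\in\mathcal S$ and $w\le w'$ imply $w'\in\mathcal S$. Then the following hold. (a) The ideal $I_0=\bigcap_{S}\mathrm{ann}\,S$ of $\Pi$, where $S$ runs over all bricks of $\mathrm{mod}\,\Pi$, equals $I_{\mathrm{cyc}}$. (b) The map $\mathcal S\mapsto\mathrm{span}_k\,\mathcal S$ is a lattice isomorphism $\mathrm{Ideals}\,\mathscr U\to\mathrm{Ideals}\,\overline\Pi$. The map $\mathcal T\mapsto\mathcal T\cap\mathrm{mod}\,\overline\Pi$ is a lattice isomorphism $\mathrm{tors}\,\Pi\to\mathrm{tors}\,\overline\Pi$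 and, when $\mathrm{tors}\,\Pi$ and $\mathrm{tors}\,\overline\Pi$ are identified by it, $I\mapsto\eta_{\overline\Pi}(I)$ is a lattice isomorphism $\mathrm{Ideals}\,\overline\Pi\to\mathrm{AlgCon}\,\Pi$. (c) For all $I,J\in\mathrm{Ideals}\,\Pi$, the following are equivalent: $\eta_\Pi(I)=\eta_\Pi(J)$; $\eta_{\overline\Pi}(\overline I)=\eta_{\overline\Pi}(\overline J)$, where $\overline I=(I+I_{\mathrm{cyc}})/I_{\mathrm{cyc}}$ and $\overline J=(J+I_{\mathrm{cyc}})/I_{\mathrm{cyc}}$; $I+I_{\mathrm{cyc}}=J+I_{\mathrm{cyc}}$; $I\cap\mathscr U=J\cap\mathscr U$. -/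

import Mathlib

universe u v

/-! ### Complete lattice congruences -/

/-- A complete congruence on a complete lattice `L`: an equivalence relation compatible with
arbitrary meets and joins. (Index types in the universe of `L` are enough: a family of pairs of
elements of `L` can be reindexed by its range in `L × L`.) -/
structure CompleteCongruence (L : Type v) [CompleteLattice L] extends Setoid L where
  iInf_rel : ∀ {ι : Type v} {x y : ι → L}, (∀ i, r (x i) (y i)) → r (⨅ i, x i) (⨅ i, y i)
  iSup_rel : ∀ {ι : Type v} {x y : ι → L}, (∀ i, r (x i) (y i)) → r (⨆ i, x i) (⨆ i, y i)

namespace CompleteCongruence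

variable {L : Type v} [CompleteLattice L]

theorem toSetoid_injective :
    Function.Injective (toSetoid : CompleteCongruence L → Setoid L) := by
  rintro ⟨s, _, _⟩ ⟨t, _, _⟩ h
  cases h
  rfl

/-- Congruences are ordered by refinement: `Θ ≤ Θ'` iff `x ≡_Θ y` implies `x ≡_Θ' y`. -/
instance instPartialOrder : PartialOrder (CompleteCongruence L) :=
  PartialOrder.lift toSetoid toSetoid_injective

end CompleteCongruence

/-! ### Torsion classes of finitely generated left modules -/

/-- A torsion class in the category of finitely generated left `A`-modules: a class of finitely
generated modules that contains the zero modules and is closed under factor modules (hence under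
isomorphisms) and extensions. -/
@[ext]
structure TorsionClass (A : Type u) [Ring A] where
  carrier : Set (ModuleCat.{u} A)
  finite : ∀ M ∈ carrier, Module.Finite A M
  zero_mem : ∀ M : ModuleCat.{u} A, Subsingleton M → M ∈ carrier
  factor_mem : ∀ (M N : ModuleCat.{u} A) (f : M →ₗ[A] N),
    Function.Surjective f → M ∈ carrier → N ∈ carrier
  ext_mem : ∀ (K M N : ModuleCat.{u} A) (f : K →ₗ[A] M) (g : M →ₗ[A] N),
    Function.Injective f → Function.Exact f g → Function.Surjective g →
      K ∈ carrier → N ∈ carrier → M ∈ carrier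

namespace TorsionClass

variable {A : Type u} [Ring A]

/-- Torsion classes are ordered by inclusion. -/
instance instPartialOrder : PartialOrder (TorsionClass A) :=
  PartialOrder.lift carrier fun _ _ h => TorsionClass.ext h

/-- The intersection of a set of torsion classes (the class of all finitely generated modules if
the set is empty). -/
instance instInfSet : InfSet (TorsionClass A) where
  sInf S :=
    { carrier := {M | Module.Finite A M ∧ ∀ T ∈ S, M ∈ T.carrier}
      finite := fun _ h => h.1
      zero_mem := fun M hM => ⟨inferInstance, fun T _ => T.zero_mem M hM⟩
      factor_mem := fun M N f hf h =>
        ⟨haveI := h.1; Module.Finite.of_surjective f hf,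
          fun T hT => T.factor_mem M N f hf (h.2 T hT)⟩
      ext_mem := fun K M N f g hf hfg hg hK hN =>
        ⟨haveI := hK.1; haveI := hN.1; Module.Finite.of_exact hfg hg,
          fun T hT => T.ext_mem K M N f g hf hfg hg (hK.2 T hT) (hN.2 T hT)⟩ }

theorem isGLB_sInf (S : Set (TorsionClass A)) : IsGLB S (sInf S) :=
  ⟨fun T hT _ hM => hM.2 T hT, fun U hU M hM => ⟨U.finite M hM, fun _ hT => hU hT hM⟩⟩

/-- The complete lattice of torsion classes: meets are intersections. -/
instance instCompleteLattice : CompleteLattice (TorsionClass A) :=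
  completeLatticeOfInf (TorsionClass A) isGLB_sInf

theorem mem_iInf {ι : Type*} {T : ι → TorsionClass A} {M : ModuleCat.{u} A} :
    M ∈ (⨅ i, T i).carrier ↔ Module.Finite A M ∧ ∀ i, M ∈ (T i).carrier := by
  constructor
  · rintro ⟨h, h'⟩
    exact ⟨h, fun i => h' _ ⟨i, rfl⟩⟩
  · rintro ⟨h, h'⟩
    refine ⟨h, ?_⟩
    rintro _ ⟨i, rfl⟩
    exact h' i

/-- For a surjective ring morphism `φ : A → B`, the torsion class `T ∩ mod B` of `B`-modules, where
a `B`-module is regarded as an `A`-module through `φ`. -/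
def restrict {B : Type u} [Ring B] (φ : A →+* B) (T : TorsionClass A) : TorsionClass B where
  carrier := {N | Module.Finite B N ∧ (ModuleCat.restrictScalars φ).obj N ∈ T.carrier}
  finite := fun _ h => h.1
  zero_mem := fun _ hM => ⟨inferInstance, T.zero_mem _ hM⟩
  factor_mem := fun _ _ f hf h =>
    ⟨haveI := h.1; Module.Finite.of_surjective f hf,
      T.factor_mem _ _ ((ModuleCat.restrictScalars φ).map (ModuleCat.ofHom f)).hom hf h.2⟩
  ext_mem := fun _ _ _ f g hf hfg hg hK hN =>
    ⟨haveI := hK.1; haveI := hN.1; Module.Finite.of_exact hfg hg,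
      T.ext_mem _ _ _ ((ModuleCat.restrictScalars φ).map (ModuleCat.ofHom f)).hom
        ((ModuleCat.restrictScalars φ).map (ModuleCat.ofHom g)).hom hf hfg hg hK.2 hN.2⟩

end TorsionClass

/-! ### Algebraic congruences -/

/-- `M` is annihilated by `I`, that is, `M` is a module over `A / I`. -/
def AnnihilatedBy {A : Type u} [Ring A] (I : TwoSidedIdeal A) (M : ModuleCat.{u} A) : Prop :=
  ∀ a ∈ I, ∀ m : M, a • m = 0

namespace TorsionClass

variable {A : Type u} [Ring A]

/-- The class of the finitely generated modules all of whose factor modules over `A / I` lie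
in `T`; it is used to see that `T ↦ T ∩ mod (A / I)` is compatible with joins. -/
def lift (I : TwoSidedIdeal A) (T : TorsionClass A) : TorsionClass A where
  carrier := {M | Module.Finite A M ∧ ∀ (Q : ModuleCat.{u} A) (q : M →ₗ[A] Q),
    Function.Surjective q → AnnihilatedBy I Q → Q ∈ T.carrier}
  finite := fun _ h => h.1
  zero_mem := fun M hM =>
    ⟨inferInstance, fun Q q hq _ => T.factor_mem M Q q hq (T.zero_mem M hM)⟩
  factor_mem := fun M N f hf h =>
    ⟨haveI := h.1; Module.Finite.of_surjective f hf,
      fun Q q hq hQ => h.2 Q (q ∘ₗ f) (hq.comp hf) hQ⟩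
  ext_mem := fun K M N f g hf hfg hg hK hN => by
    refine ⟨haveI := hK.1; haveI := hN.1; Module.Finite.of_exact hfg hg, fun Q q hq hQ => ?_⟩
    let R : Submodule A Q := LinearMap.range (q ∘ₗ f)
    have hker : LinearMap.ker g ≤ LinearMap.ker (R.mkQ ∘ₗ q) := by
      intro m hm
      obtain ⟨x, rfl⟩ := (hfg m).1 hm
      exact (Submodule.Quotient.mk_eq_zero R).2 ⟨x, rfl⟩
    let e := (LinearMap.quotKerEquivOfSurjective g hg).symm
    let s : N →ₗ[A] Q ⧸ R := ((LinearMap.ker g).liftQ (R.mkQ ∘ₗ q) hker) ∘ₗ e.toLinearMap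
    have hs : Function.Surjective s := by
      intro z
      obtain ⟨y, rfl⟩ := R.mkQ_surjective z
      obtain ⟨m, rfl⟩ := hq y
      refine ⟨g m, ?_⟩
      have : e (g m) = (LinearMap.ker g).mkQ m := by
        rw [LinearEquiv.symm_apply_eq]
        rfl
      simp [s, this]
    have h1 : ModuleCat.of A R ∈ T.carrier :=
      hK.2 (ModuleCat.of A R) (LinearMap.rangeRestrict (q ∘ₗ f))
        (LinearMap.surjective_rangeRestrict _) fun a ha m => Subtype.ext (hQ a ha m.1)
    have h2 : ModuleCat.of A (Q ⧸ R) ∈ T.carrier := by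
      refine hN.2 (ModuleCat.of A (Q ⧸ R)) s hs fun a ha z => ?_
      obtain ⟨y, rfl⟩ := R.mkQ_surjective z
      change a • R.mkQ y = 0
      rw [← map_smul, hQ a ha y, map_zero]
    exact T.ext_mem (ModuleCat.of A R) Q (ModuleCat.of A (Q ⧸ R)) R.subtype R.mkQ
      R.injective_subtype (LinearMap.exact_subtype_mkQ R) R.mkQ_surjective h1 h2

theorem mem_iSup_of_rel (I : TwoSidedIdeal A) {ι : Type*} {T U : ι → TorsionClass A}
    (h : ∀ i (M : ModuleCat.{u} A), AnnihilatedBy I M →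
      (M ∈ (T i).carrier ↔ M ∈ (U i).carrier))
    {M : ModuleCat.{u} A} (hI : AnnihilatedBy I M) (hM : M ∈ (⨆ i, T i).carrier) :
    M ∈ (⨆ i, U i).carrier := by
  have hle : ⨆ i, T i ≤ lift I (⨆ i, U i) := iSup_le fun i N hN =>
    ⟨(T i).finite N hN, fun Q q hq hQ =>
      le_iSup U i ((h i Q hQ).1 ((T i).factor_mem N Q q hq hN))⟩
  exact (hle hM).2 M LinearMap.id Function.surjective_id hI

end TorsionClass

/-- The map `η_A : I ↦ Θ_I`, where `T ≡ U` for `Θ_I` if and only if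
`T ∩ mod (A / I) = U ∩ mod (A / I)`. -/
def eta {A : Type u} [Ring A] (I : TwoSidedIdeal A) : CompleteCongruence (TorsionClass A) where
  r T U := ∀ M : ModuleCat.{u} A, AnnihilatedBy I M → (M ∈ T.carrier ↔ M ∈ U.carrier)
  iseqv :=
    ⟨fun _ _ _ => Iff.rfl, fun h M hM => (h M hM).symm,
      fun h h' M hM => (h M hM).trans (h' M hM)⟩
  iInf_rel := fun h M hM => by
    simp only [TorsionClass.mem_iInf]
    exact and_congr_right fun _ => forall_congr' fun i => h i M hM
  iSup_rel := fun h M hM =>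
    ⟨TorsionClass.mem_iSup_of_rel I h hM,
      TorsionClass.mem_iSup_of_rel I (fun i N hN => (h i N hN).symm) hM⟩

/-- The poset of algebraic congruences: the image of `η_A`, ordered by refinement. -/
abbrev AlgCon (A : Type u) [Ring A] : Type (u + 1) :=
  {Θ : CompleteCongruence (TorsionClass A) // Θ ∈ Set.range (eta (A := A))}

/-! ### Bricks -/

/-- A brick: a finitely generated module whose endomorphism ring is a division ring. -/
def IsBrick (A : Type u) [Ring A] (S : ModuleCat.{u} A) : Prop :=
  Module.Finite A S ∧ Nontrivial (Module.End A S) ∧ ∀ f : Module.End A S, f ≠ 0 → IsUnit f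

/-- The ideal `I₀`: the intersection of the annihilators of all bricks. -/
def brickIdeal (A : Type u) [Ring A] : TwoSidedIdeal A :=
  TwoSidedIdeal.mk' {a | ∀ S : ModuleCat.{u} A, IsBrick A S → ∀ s : S, a • s = 0}
    (fun _ _ s => zero_smul A s)
    (fun hx hy S hS s => by rw [add_smul, hx S hS s, hy S hS s, add_zero])
    (fun hx S hS s => by rw [neg_smul, hx S hS s, neg_zero])
    (fun hy S hS s => by rw [mul_smul, hy S hS s, smul_zero])
    (fun hx S hS s => by rw [mul_smul, hx S hS])

/-! ### Path algebras and preprojective algebras -/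

namespace PathAlgebra

/-- The generators of the path algebra of a quiver: its vertices and its arrows. -/
inductive Gen (V : Type) [Quiver.{0} V] : Type
  | vertex (i : V) : Gen V
  | arrow {i j : V} (a : i ⟶ j) : Gen V

/-- The defining relations of the path algebra of a finite quiver: the vertices `e_i` form a
complete system of orthogonal idempotents, and `e_i a = a = a e_j` for an arrow `a : i → j`.
Paths are composed from left to right. -/
inductive Rel (k : Type u) [Field k] (V : Type) [Quiver.{0} V] [Fintype V] :
    FreeAlgebra k (Gen V) → FreeAlgebra k (Gen V) → Prop
  | idem (i : V) : Rel k V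
      (FreeAlgebra.ι k (Gen.vertex i) * FreeAlgebra.ι k (Gen.vertex i))
      (FreeAlgebra.ι k (Gen.vertex i))
  | orth (i j : V) (h : i ≠ j) : Rel k V
      (FreeAlgebra.ι k (Gen.vertex i) * FreeAlgebra.ι k (Gen.vertex j)) 0
  | sum_eq_one : Rel k V (∑ i : V, FreeAlgebra.ι k (Gen.vertex i)) 1
  | source {i j : V} (a : i ⟶ j) : Rel k V
      (FreeAlgebra.ι k (Gen.vertex i) * FreeAlgebra.ι k (Gen.arrow a))
      (FreeAlgebra.ι k (Gen.arrow a))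
  | target {i j : V} (a : i ⟶ j) : Rel k V
      (FreeAlgebra.ι k (Gen.arrow a) * FreeAlgebra.ι k (Gen.vertex j))
      (FreeAlgebra.ι k (Gen.arrow a))

end PathAlgebra

/-- The path algebra of a finite quiver over a field. -/
abbrev PathAlgebra (k : Type u) [Field k] (V : Type) [Quiver.{0} V] [Fintype V] : Type u :=
  RingQuot (PathAlgebra.Rel k V)

namespace PathAlgebra

variable (k : Type u) [Field k] {V : Type} [Quiver.{0} V] [Fintype V]

/-- The idempotent `e_i` of a vertex. -/
noncomputable def vertex (i : V) : PathAlgebra k V :=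
  RingQuot.mkAlgHom k (Rel k V) (FreeAlgebra.ι k (Gen.vertex i))

/-- The element of the path algebra given by an arrow. -/
noncomputable def arrow {i j : V} (a : i ⟶ j) : PathAlgebra k V :=
  RingQuot.mkAlgHom k (Rel k V) (FreeAlgebra.ι k (Gen.arrow a))

/-- The element of the path algebra given by a path. -/
noncomputable def ofPath {i : V} : ∀ {j : V}, Quiver.Path i j → PathAlgebra k V
  | _, Quiver.Path.nil => vertex k i
  | _, Quiver.Path.cons p a => ofPath p * arrow k a

end PathAlgebra

instance symmetrifyFintype (V : Type) [Fintype V] : Fintype (Quiver.Symmetrify V) :=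
  inferInstanceAs (Fintype V)

/-- The relation `∑ (a a* - a* a) = 0` of the preprojective algebra; the sum runs over the arrows
`a` of the quiver `V`, and `a*` is the reversed arrow in the double quiver. -/
inductive PreprojRel (k : Type u) [Field k] (V : Type) [Quiver.{0} V] [Fintype V]
    [∀ i j : V, Fintype (i ⟶ j)] :
    PathAlgebra k (Quiver.Symmetrify V) → PathAlgebra k (Quiver.Symmetrify V) → Prop
  | rel : PreprojRel k V
      (∑ i : V, ∑ j : V, ∑ a : i ⟶ j,
        (PathAlgebra.arrow k a.toPos * PathAlgebra.arrow k a.toNeg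
          - PathAlgebra.arrow k a.toNeg * PathAlgebra.arrow k a.toPos)) 0

/-- The preprojective algebra of a finite quiver. -/
abbrev Preprojective (k : Type u) [Field k] (V : Type) [Quiver.{0} V] [Fintype V]
    [∀ i j : V, Fintype (i ⟶ j)] : Type u :=
  RingQuot (PreprojRel k V)

/-! ### Non-revisiting paths -/

/-- A path of a quiver that visits each vertex at most once (trivial paths included). -/
structure NonRevisitingPath (V : Type) [Quiver.{0} V] where
  source : V
  target : V
  path : Quiver.Path source target
  nodup : path.vertices.Nodup

namespace NonRevisitingPath

variable {V : Type} [Quiver.{0} V]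

/-- `p ≤ q` if `p` is a subpath of `q`. -/
instance instPartialOrder : PartialOrder (NonRevisitingPath V) where
  le p q := ∃ (b : Quiver.Path q.source p.source) (c : Quiver.Path p.target q.target),
    q.path = b.comp (p.path.comp c)
  le_refl p := ⟨Quiver.Path.nil, Quiver.Path.nil, by simp⟩
  le_trans p q r := by
    rintro ⟨b, c, h⟩ ⟨b', c', h'⟩
    exact ⟨b'.comp b, c.comp c', by rw [h', h]; simp only [Quiver.Path.comp_assoc]⟩
  le_antisymm p q := by
    rintro ⟨b, c, h⟩ ⟨b', c', h'⟩
    obtain ⟨s, t, p, hp⟩ := p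
    obtain ⟨s', t', q, hq⟩ := q
    dsimp only at b c h b' c' h'
    have e := congrArg Quiver.Path.length h
    have e' := congrArg Quiver.Path.length h'
    simp only [Quiver.Path.length_comp] at e e'
    have hb : b.length = 0 := by omega
    have hc : c.length = 0 := by omega
    obtain rfl := Quiver.Path.eq_of_length_zero b hb
    obtain rfl := Quiver.Path.eq_of_length_zero c hc
    obtain rfl := Quiver.Path.eq_nil_of_length_zero b hb
    obtain rfl := Quiver.Path.eq_nil_of_length_zero c hc
    simp only [Quiver.Path.nil_comp, Quiver.Path.comp_nil] at h
    subst h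
    rfl

end NonRevisitingPath

/-! ### Type `A` -/

/-- The vertices of the quiver `1 → 2 → ⋯ → n` of type `A_n` (numbered from `0`). A type synonym
is used because `Fin n` already carries the quiver of its order. -/
def TypeA (n : ℕ) : Type := Fin n

instance TypeA.instFintype (n : ℕ) : Fintype (TypeA n) := inferInstanceAs (Fintype (Fin n))

instance TypeA.instDecidableEq (n : ℕ) : DecidableEq (TypeA n) := inferInstanceAs (DecidableEq (Fin n))

/-- The number of a vertex. -/
def TypeA.val {n : ℕ} (i : TypeA n) : ℕ := Fin.val i

/-- One arrow `i → i + 1` for each vertex `i` but the last. -/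
instance TypeA.instQuiver (n : ℕ) : Quiver.{0} (TypeA n) where
  Hom i j := PLift (i.val + 1 = j.val)

instance TypeA.instFintypeHom {n : ℕ} (i j : TypeA n) : Fintype (i ⟶ j) :=
  inferInstanceAs (Fintype (PLift (i.val + 1 = j.val)))

/-- The preprojective algebra `Π` of type `A_n`. -/
abbrev PiA (k : Type u) [Field k] (n : ℕ) : Type u := Preprojective k (TypeA n)

/-- The poset `𝒰` of non-revisiting paths in the quiver of `Π`. -/
abbrev PathsA (n : ℕ) : Type := NonRevisitingPath (Quiver.Symmetrify (TypeA n))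

namespace PiA

variable (k : Type u) [Field k] (n : ℕ)

/-- The element of `Π` given by an arrow of the double quiver. -/
noncomputable def arrow {i j : Quiver.Symmetrify (TypeA n)} (a : i ⟶ j) : PiA k n :=
  RingQuot.mkAlgHom k (PreprojRel k (TypeA n)) (PathAlgebra.arrow k a)

/-- The element of `Π` given by a non-revisiting path. -/
noncomputable def ofPath (p : PathsA n) : PiA k n :=
  RingQuot.mkAlgHom k (PreprojRel k (TypeA n)) (PathAlgebra.ofPath k p.path)

/-- The two-sided ideal `I_cyc` generated by all 2-cycles. -/
noncomputable def cycIdeal : TwoSidedIdeal (PiA k n) :=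
  TwoSidedIdeal.span {z | ∃ (i j : Quiver.Symmetrify (TypeA n)) (a : i ⟶ j) (b : j ⟶ i),
    z = arrow k n a * arrow k n b}

end PiA

/-- The algebra `Π / I_cyc`. -/
abbrev PiABar (k : Type u) [Field k] (n : ℕ) : Type u := (PiA.cycIdeal k n).ringCon.Quotient

/-- The canonical surjection `Π → Π / I_cyc`. -/
noncomputable abbrev PiA.toBar (k : Type u) [Field k] (n : ℕ) : PiA k n →+* PiABar k n :=
  (PiA.cycIdeal k n).ringCon.mk'

/-!
Let `c` be the sum of the 2-cycles `a a*`, where `a` runs over the arrows of `A_n`. The defining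
relation of `Π` says that every 2-cycle at the vertex `i` equals `e_i c`, so `c` is central and
generates `I_cyc`; since `e_1 c = 0`, moving `c` along the arrows to the vertex `1` gives
`e_i c ^ i = 0`, so `c` is nilpotent. A central nilpotent element acts by zero on every brick, and a
module `M` is an iterated extension of the modules `c ^ m M / c ^ (m + 1) M`, which are factor
modules of `M`, so `M` lies in a torsion class as soon as its factor modules killed by `c` do.

Every path of the double quiver equals `w c ^ m` with `w` the shortest path between its endpoints,
so an element of the corner `e_i Π e_j` has the form `w q(c)` for a polynomial `q`. It lies in
`I_cyc` if `q(0) = 0` and generates the same ideal as `w` otherwise; so an ideal that contains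
`I_cyc` is determined by the non-revisiting paths in it. Conversely, such a path `p` from `i` to `j`
is the longest path that acts nontrivially on a uniserial brick, which is annihilated by an ideal
`I` if and only if `p ∉ I`. If `eta I ≤ eta J` then `I` annihilates each brick `S` annihilated by
`J`: otherwise the modules without nonzero morphisms to `S` and the modules whose nonzero morphisms
to `S` are surjective form two torsion classes that agree modulo `I`, but not modulo `J`, since `S`
lies only in the second.
-/

/-! ### Polynomials in a nilpotent element -/

section Polynomials

open Polynomial

variable {R A : Type*}

theorem aeval_eq_mul_aeval_divX_add [CommSemiring R] [Semiring A] [Algebra R A] (c : A) (q : R[X]) :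
    aeval c q = c * aeval c q.divX + algebraMap R A (q.coeff 0) := by
  conv_lhs => rw [← X_mul_divX_add q, map_add, map_mul, aeval_X, aeval_C]

theorem isUnit_aeval_of_isNilpotent [CommRing R] [Ring A] [Algebra R A] {c : A}
    (hc : IsNilpotent c) {q : R[X]} (hq : IsUnit (q.coeff 0)) : IsUnit (aeval c q) := by
  have hmul : Commute c (aeval c q.divX) := by
    simpa only [aeval_X] using (Commute.all X q.divX).map (aeval c)
  rw [aeval_eq_mul_aeval_divX_add]
  exact (hmul.isNilpotent_mul_right hc).isUnit_add_right_of_commute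
    (hq.map (algebraMap R A)) (Algebra.commutes _ _).symm

end Polynomials

/-! ### Two-sided ideals -/

section TwoSidedIdeals

open TwoSidedIdeal

variable {A B : Type*} [Ring A] [Ring B]

theorem mem_span_singleton_iff_dvd_of_mem_center {c x : A} (hc : c ∈ Set.center A) :
    x ∈ span {c} ↔ c ∣ x := by
  have hcomm (a : A) : a * c = c * a := ((Set.mem_center_iff.1 hc).comm a).symm
  let K : TwoSidedIdeal A := .mk' {y | c ∣ y} (dvd_zero c) dvd_add (fun h => (dvd_neg ..).2 h)
    (by rintro a _ ⟨b, rfl⟩; exact ⟨a * b, by rw [← mul_assoc, hcomm, mul_assoc]⟩)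
    (fun h => dvd_mul_of_dvd_left h _)
  have hK {y : A} : y ∈ K ↔ c ∣ y := mem_mk' ..
  have hspan : span {c} ≤ K := span_le.2 (Set.singleton_subset_iff.2 (hK.2 dvd_rfl))
  refine ⟨fun h => hK.1 (hspan h), ?_⟩
  rintro ⟨b, rfl⟩
  exact mul_mem_right _ _ _ (subset_span rfl)

theorem comap_map_eq_sup_ker (φ : A →+* B) [RingHomSurjective φ] (I : TwoSidedIdeal A) :
    (I.map φ).comap φ = I ⊔ ker φ := by
  refine le_antisymm (fun a ha => ?_) (sup_le (fun a ha => ?_) fun a ha => ?_)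
  · let π := (I ⊔ ker φ).ringCon.mk'
    have hπ {x : A} : π x = 0 ↔ x ∈ I ⊔ ker φ := by rw [← mem_ker, ker_ringCon_mk']
    let ψ := φ.liftOfSurjective φ.surjective ⟨π, fun x hx =>
      hπ.2 (le_sup_right (a := I) ((mem_ker φ).2 hx))⟩
    have hψ (x : A) : ψ (φ x) = π x := φ.liftOfSurjective_comp_apply φ.surjective _ x
    have hmap : I.map φ ≤ ker ψ := span_le.2 <| by
      rintro _ ⟨x, hx, rfl⟩
      exact (mem_ker ψ).2 ((hψ x).trans (hπ.2 (le_sup_left (b := ker φ) hx)))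
    exact hπ.1 ((hψ a).symm.trans ((mem_ker ψ).1 (hmap ((mem_comap φ).1 ha))))
  · exact (mem_comap φ).2 (subset_span ⟨a, ha, rfl⟩)
  · rw [mem_comap, (mem_ker φ).1 ha]
    exact (I.map φ).zero_mem

end TwoSidedIdeals

/-! ### Restriction of torsion classes along a surjection -/

theorem exists_comp_eq_of_exact {A B K M N S : Type*} [Ring A] [Ring B] {φ : A →+* B}
    [AddCommGroup K] [AddCommGroup M] [AddCommGroup N] [AddCommGroup S] [Module A K] [Module A M]
    [Module A N] [Module B S] {f : K →ₗ[A] M} {g : M →ₗ[A] N} (hfg : Function.Exact f g)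
    (hg : Function.Surjective g) (t : M →ₛₗ[φ] S) (ht : ∀ x, t (f x) = 0) :
    ∃ s : N →ₛₗ[φ] S, s.comp g = t := by
  have hker : LinearMap.ker g ≤ LinearMap.ker t := by
    intro m hm
    obtain ⟨x, rfl⟩ := (hfg m).1 hm
    exact ht x
  refine ⟨((LinearMap.ker g).liftQ t hker).comp
    (g.quotKerEquivOfSurjective hg).symm.toLinearMap, LinearMap.ext fun m => ?_⟩
  exact congrArg _ (g.quotKerEquivOfSurjective_symm_apply hg m)

section QuotientRing

variable {A B : Type u} [Ring A] [Ring B] (φ : A →+* B) [RingHomSurjective φ]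

theorem finite_restrictScalars_iff (N : ModuleCat.{u} B) :
    Module.Finite A ((ModuleCat.restrictScalars φ).obj N) ↔ Module.Finite B N :=
  LinearMap.finite_iff_of_bijective
    (show (ModuleCat.restrictScalars φ).obj N →ₛₗ[φ] N from
      { AddMonoidHom.id N with map_smul' := fun _ _ => rfl }) Function.bijective_id

theorem exists_restrictScalars_equiv {M : ModuleCat.{u} A}
    (hM : AnnihilatedBy (TwoSidedIdeal.ker φ) M) :
    ∃ N : ModuleCat.{u} B, Nonempty ((ModuleCat.restrictScalars φ).obj N ≃ₗ[A] M) := by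
  let _ : SMul B M := ⟨fun b m => Function.surjInv φ.surjective b • m⟩
  have hsmul (a : A) (m : M) : φ a • m = a • m := by
    have h := hM (Function.surjInv φ.surjective (φ a) - a)
      ((TwoSidedIdeal.mem_ker φ).2 (by rw [map_sub, Function.surjInv_eq φ.surjective, sub_self])) m
    rwa [sub_smul, sub_eq_zero] at h
  let _ : Module B M := Function.Surjective.moduleLeft φ φ.surjective hsmul
  exact ⟨ModuleCat.of B M, ⟨{ AddEquiv.refl M with map_smul' := hsmul }⟩⟩

end QuotientRing

theorem AnnihilatedBy.of_surjective {A : Type u} [Ring A] {I : TwoSidedIdeal A}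
    {M N : ModuleCat.{u} A} (h : AnnihilatedBy I M) (f : M →ₗ[A] N) (hf : Function.Surjective f) :
    AnnihilatedBy I N := by
  intro a ha n
  obtain ⟨m, rfl⟩ := hf n
  rw [← map_smul, h a ha, map_zero]

theorem annihilatedBy_sup_iff {A : Type u} [Ring A] {I J : TwoSidedIdeal A}
    {M : ModuleCat.{u} A} :
    AnnihilatedBy (I ⊔ J) M ↔ AnnihilatedBy I M ∧ AnnihilatedBy J M := by
  refine ⟨fun h => ⟨fun a ha => h a (le_sup_left (b := J) ha),
    fun a ha => h a (le_sup_right (a := I) ha)⟩, fun ⟨hI, hJ⟩ a ha m => ?_⟩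
  obtain ⟨x, hx, y, hy, rfl⟩ := TwoSidedIdeal.mem_sup.1 ha
  rw [add_smul, hI x hx, hJ y hy, add_zero]

theorem annihilatedBy_span_singleton_iff {A : Type u} [Ring A] {c : A} (hc : c ∈ Set.center A)
    {M : ModuleCat.{u} A} : AnnihilatedBy (.span {c}) M ↔ ∀ m : M, c • m = 0 := by
  refine ⟨fun h => h c (TwoSidedIdeal.subset_span rfl), fun h a ha m => ?_⟩
  obtain ⟨b, rfl⟩ := (mem_span_singleton_iff_dvd_of_mem_center hc).1 ha
  rw [mul_smul, h]

namespace TorsionClass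

variable {A B : Type u} [Ring A] [Ring B]

theorem mem_iff_of_equiv (T : TorsionClass A) {M N : ModuleCat.{u} A} (e : M ≃ₗ[A] N) :
    M ∈ T.carrier ↔ N ∈ T.carrier :=
  ⟨T.factor_mem M N e.toLinearMap e.surjective,
    T.factor_mem N M e.symm.toLinearMap e.symm.surjective⟩

theorem mem_of_forall_factor (T : TorsionClass A) {c : A} (hc : c ∈ Set.center A) {r : ℕ}
    (M : ModuleCat.{u} A) (hM : ∀ m : M, c ^ r • m = 0)
    (hT : ∀ (Q : ModuleCat.{u} A) (q : M →ₗ[A] Q), Function.Surjective q →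
      AnnihilatedBy (.span {c}) Q → Q ∈ T.carrier) :
    M ∈ T.carrier := by
  induction r generalizing M with
  | zero =>
    simp only [pow_zero, one_smul] at hM
    exact T.zero_mem M ⟨fun x y => (hM x).trans (hM y).symm⟩
  | succ r ih =>
    let l : Module.End A M := .smulLeft c hc
    let K := LinearMap.range l
    have hK : ModuleCat.of A K ∈ T.carrier := by
      refine ih (ModuleCat.of A K) ?_ fun Q q hq hQ =>
        hT Q (q ∘ₗ l.rangeRestrict) (hq.comp l.surjective_rangeRestrict) hQ
      rintro ⟨_, m, rfl⟩
      refine Subtype.ext ?_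
      change c ^ r • c • m = 0
      rw [← mul_smul, ← pow_succ, hM]
    have hMK : ModuleCat.of A (M ⧸ K) ∈ T.carrier := by
      refine hT _ K.mkQ K.mkQ_surjective ((annihilatedBy_span_singleton_iff hc).2 fun x => ?_)
      obtain ⟨m, rfl⟩ := K.mkQ_surjective x
      exact (Submodule.Quotient.mk_eq_zero K).2 ⟨m, rfl⟩
    exact T.ext_mem (ModuleCat.of A K) M (ModuleCat.of A (M ⧸ K)) K.subtype K.mkQ
      K.injective_subtype (LinearMap.exact_subtype_mkQ K) K.mkQ_surjective hK hMK

/-- For a surjective ring morphism `φ : A → B`, the class of the finitely generated `A`-modules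
all of whose factor modules over `B` lie in `T`; a section of `restrict φ`. -/
def induce (φ : A →+* B) [RingHomSurjective φ] (T : TorsionClass B) : TorsionClass A where
  carrier := {M | Module.Finite A M ∧ ∀ (N : ModuleCat.{u} B) (q : M →ₛₗ[φ] N),
    Function.Surjective q → N ∈ T.carrier}
  finite _ h := h.1
  zero_mem M _ := ⟨inferInstance, fun N _ hq => T.zero_mem N hq.subsingleton⟩
  factor_mem M N f hf h :=
    ⟨haveI := h.1; Module.Finite.of_surjective f hf, fun Q q hq => h.2 Q (q.comp f) (hq.comp hf)⟩
  ext_mem K M N f g _ hfg hg hK hN := by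
    refine ⟨haveI := hK.1; haveI := hN.1; Module.Finite.of_exact hfg hg, fun Q q hq => ?_⟩
    let R : Submodule B Q := LinearMap.range (q.comp f)
    have hR : ModuleCat.of B R ∈ T.carrier :=
      hK.2 _ (q.comp f).rangeRestrict (q.comp f).surjective_rangeRestrict
    obtain ⟨s, hs⟩ := exists_comp_eq_of_exact hfg hg (R.mkQ.comp q) fun x =>
      (Submodule.Quotient.mk_eq_zero R).2 ⟨x, rfl⟩
    have hsg : Function.Surjective (s.comp g) := hs ▸ R.mkQ_surjective.comp hq
    have hQR : ModuleCat.of B (Q ⧸ R) ∈ T.carrier :=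
      hN.2 _ s (Function.Surjective.of_comp (g := g) hsg)
    exact T.ext_mem (ModuleCat.of B R) Q (ModuleCat.of B (Q ⧸ R)) R.subtype R.mkQ
      R.injective_subtype (LinearMap.exact_subtype_mkQ R) R.mkQ_surjective hR hQR

theorem restrict_induce (φ : A →+* B) [RingHomSurjective φ] (T : TorsionClass B) :
    (T.induce φ).restrict φ = T := by
  refine TorsionClass.ext (Set.ext fun N => ⟨fun h => ?_, fun h => ?_⟩)
  · exact h.2.2 N { AddMonoidHom.id N with map_smul' := fun _ _ => rfl } Function.surjective_id
  · have hN := T.finite N h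
    refine ⟨hN, (finite_restrictScalars_iff φ N).2 hN, fun N' q hq => ?_⟩
    let q' : N →ₗ[B] N' :=
      { toFun := q
        map_add' := map_add q
        map_smul' := fun b x => by
          obtain ⟨a, rfl⟩ := φ.surjective b
          exact q.map_smulₛₗ a x }
    exact T.factor_mem N N' q' hq h

theorem restrict_surjective (φ : A →+* B) [RingHomSurjective φ] :
    Function.Surjective (restrict φ) :=
  fun T => ⟨T.induce φ, restrict_induce φ T⟩

theorem mem_restrict_iff (φ : A →+* B) [RingHomSurjective φ] {T : TorsionClass A}
    {N : ModuleCat.{u} B} :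
    N ∈ (T.restrict φ).carrier ↔ (ModuleCat.restrictScalars φ).obj N ∈ T.carrier :=
  ⟨fun h => h.2, fun h => ⟨(finite_restrictScalars_iff φ N).1 (T.finite _ h), h⟩⟩

theorem restrict_le_restrict_iff {φ : A →+* B} [RingHomSurjective φ] {c : A}
    (hc : c ∈ Set.center A) (hnil : IsNilpotent c) (hφ : TwoSidedIdeal.ker φ = .span {c})
    {T U : TorsionClass A} : T.restrict φ ≤ U.restrict φ ↔ T ≤ U := by
  refine ⟨fun h M hM => ?_, fun h N hN => ⟨hN.1, h hN.2⟩⟩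
  obtain ⟨r, hr⟩ := hnil
  refine U.mem_of_forall_factor hc M (fun m => by rw [hr, zero_smul]) fun Q q hq hQ => ?_
  obtain ⟨N, ⟨e⟩⟩ := exists_restrictScalars_equiv φ (hφ ▸ hQ)
  rw [← U.mem_iff_of_equiv e, ← mem_restrict_iff φ]
  apply h
  rw [mem_restrict_iff φ, T.mem_iff_of_equiv e]
  exact T.factor_mem M Q q hq hM

/-- Restriction along a surjective ring morphism whose kernel is generated by a central nilpotent
element, as an isomorphism between lattices of torsion classes. -/
noncomputable def restrictOrderIso (φ : A →+* B) [RingHomSurjective φ] {c : A}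
    (hc : c ∈ Set.center A) (hnil : IsNilpotent c) (hφ : TwoSidedIdeal.ker φ = .span {c}) :
    TorsionClass A ≃o TorsionClass B :=
  RelIso.ofSurjective
    (OrderEmbedding.ofMapLEIff (restrict φ) fun _ _ => restrict_le_restrict_iff hc hnil hφ)
    (restrict_surjective φ)

/-- The class of the finitely generated modules that have no nonzero morphism to `S`. -/
def leftPerp (S : ModuleCat.{u} A) : TorsionClass A where
  carrier := {M | Module.Finite A M ∧ ∀ f : M →ₗ[A] S, f = 0}
  finite _ h := h.1
  zero_mem M _ := ⟨inferInstance, fun _ => Subsingleton.elim _ _⟩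
  factor_mem M N f hf h :=
    ⟨haveI := h.1; Module.Finite.of_surjective f hf, fun g =>
      (LinearMap.cancel_right hf).1 ((h.2 (g ∘ₗ f)).trans (LinearMap.zero_comp f).symm)⟩
  ext_mem K M N f g _ hfg hg hK hN :=
    ⟨haveI := hK.1; haveI := hN.1; Module.Finite.of_exact hfg hg, fun t => by
      obtain ⟨s, rfl⟩ := exists_comp_eq_of_exact hfg hg t (LinearMap.congr_fun (hK.2 (t ∘ₗ f)))
      rw [hN.2 s, LinearMap.zero_comp]⟩

/-- The class of the finitely generated modules whose nonzero morphisms to `S` are surjective. If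
`S` is a brick, it contains `S`, whereas `leftPerp S` does not. -/
def surjectiveOrZero (S : ModuleCat.{u} A) : TorsionClass A where
  carrier := {M | Module.Finite A M ∧ ∀ f : M →ₗ[A] S, f ≠ 0 → Function.Surjective f}
  finite _ h := h.1
  zero_mem M _ := ⟨inferInstance, fun _ hf => absurd (Subsingleton.elim _ _) hf⟩
  factor_mem M N f hf h :=
    ⟨haveI := h.1; Module.Finite.of_surjective f hf, fun g hg =>
      Function.Surjective.of_comp (g := f) (h.2 (g ∘ₗ f) fun h0 =>
        hg ((LinearMap.cancel_right hf).1 (h0.trans (LinearMap.zero_comp f).symm)))⟩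
  ext_mem K M N f g _ hfg hg hK hN :=
    ⟨haveI := hK.1; haveI := hN.1; Module.Finite.of_exact hfg hg, fun t ht => by
      by_cases h : t ∘ₗ f = 0
      · obtain ⟨s, rfl⟩ := exists_comp_eq_of_exact hfg hg t (LinearMap.congr_fun h)
        refine (hN.2 s fun hs => ht ?_).comp hg
        rw [hs, LinearMap.zero_comp]
      · exact Function.Surjective.of_comp (g := f) (hK.2 _ h)⟩

end TorsionClass

/-! ### Algebraic congruences and bricks -/

section Eta

variable {A B : Type u} [Ring A] [Ring B]

theorem eta_le_eta_iff {I J : TwoSidedIdeal A} :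
    eta I ≤ eta J ↔ ∀ T U : TorsionClass A, (eta I).r T U → (eta J).r T U :=
  ⟨fun h _ _ hTU => h hTU, fun h T U hTU => h T U hTU⟩

theorem eta_mono : Monotone (eta (A := A)) :=
  fun _ _ h => eta_le_eta_iff.2 fun _ _ hTU M hM => hTU M fun a ha => hM a (h ha)

theorem eta_comap_rel_iff (φ : A →+* B) [RingHomSurjective φ] {I : TwoSidedIdeal B}
    {T U : TorsionClass A} :
    (eta (I.comap φ)).r T U ↔ (eta I).r (T.restrict φ) (U.restrict φ) := by
  refine ⟨fun h N hN => ?_, fun h M hM => ?_⟩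
  · rw [TorsionClass.mem_restrict_iff φ, TorsionClass.mem_restrict_iff φ]
    exact h _ fun a ha m => hN (φ a) ((TwoSidedIdeal.mem_comap φ).1 ha) m
  · have hker : TwoSidedIdeal.ker φ ≤ I.comap φ := fun a ha => by
      rw [TwoSidedIdeal.mem_comap, (TwoSidedIdeal.mem_ker φ).1 ha]
      exact I.zero_mem
    obtain ⟨N, ⟨e⟩⟩ := exists_restrictScalars_equiv φ fun a ha => hM a (hker ha)
    have hN : AnnihilatedBy I N := by
      intro b hb x
      obtain ⟨a, rfl⟩ := φ.surjective b
      exact hM.of_surjective e.symm.toLinearMap e.symm.surjective a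
        ((TwoSidedIdeal.mem_comap φ).2 hb) x
    rw [← T.mem_iff_of_equiv e, ← U.mem_iff_of_equiv e, ← TorsionClass.mem_restrict_iff φ,
      ← TorsionClass.mem_restrict_iff φ]
    exact h N hN

theorem eta_comap_le_eta_comap_iff (φ : A →+* B) [RingHomSurjective φ] {I J : TwoSidedIdeal B} :
    eta (I.comap φ) ≤ eta (J.comap φ) ↔ eta I ≤ eta J := by
  simp only [eta_le_eta_iff, eta_comap_rel_iff, (TorsionClass.restrict_surjective φ).forall]

theorem eta_sup_span_singleton {c : A} (hc : c ∈ Set.center A) (hnil : IsNilpotent c)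
    (I : TwoSidedIdeal A) : eta (I ⊔ .span {c}) = eta I := by
  refine le_antisymm (eta_le_eta_iff.2 fun T U h M hM => ?_) (eta_mono le_sup_left)
  obtain ⟨r, hr⟩ := hnil
  have mem_of_mem {T U : TorsionClass A} (h : (eta (I ⊔ .span {c})).r T U)
      (hT : M ∈ T.carrier) : M ∈ U.carrier :=
    U.mem_of_forall_factor hc M (fun m => by rw [hr, zero_smul]) fun Q q hq hQ =>
      (h Q (annihilatedBy_sup_iff.2 ⟨hM.of_surjective q hq, hQ⟩)).1 (T.factor_mem M Q q hq hT)
  exact ⟨mem_of_mem h, mem_of_mem ((eta _).iseqv.symm h)⟩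

namespace IsBrick

theorem of_forall_end_eq_smul {k : Type*} [Field k] {S : Type u}
    [AddCommGroup S] [Module k S] [Module A S] [Module.Finite A S] [Nontrivial S]
    (h : ∀ f : Module.End A S, ∃ r : k, ∀ x, f x = r • x) :
    IsBrick A (ModuleCat.of A S) := by
  refine ⟨inferInstance, inferInstanceAs (Nontrivial (Module.End A S)), fun f hf => ?_⟩
  obtain ⟨r, hr⟩ := h f
  have hr0 : r ≠ 0 := by
    rintro rfl
    exact hf (LinearMap.ext fun x => (hr x).trans (zero_smul k x))
  have hbij : Function.Bijective f := by
    convert (LinearEquiv.smulOfNeZero k S r hr0).bijective using 1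
    exact funext hr
  exact (Module.End.isUnit_iff f).2 hbij

theorem annihilatedBy_span_singleton {c : A} (hc : c ∈ Set.center A) (hnil : IsNilpotent c)
    {S : ModuleCat.{u} A} (hS : IsBrick A S) : AnnihilatedBy (.span {c}) S := by
  rw [annihilatedBy_span_singleton_iff hc]
  have hl : IsNilpotent (Module.End.smulLeft (M := S) c hc) := by
    obtain ⟨r, hr⟩ := hnil
    refine ⟨r, LinearMap.ext fun s => ?_⟩
    have hpow (m : ℕ) : (Module.End.smulLeft (M := S) c hc ^ m) s = c ^ m • s := by
      induction m with
      | zero => simp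
      | succ m ih => rw [pow_succ', pow_succ', Module.End.mul_apply, ih, mul_smul]; rfl
    rw [hpow, hr, zero_smul, LinearMap.zero_apply]
  have := hS.2.1
  by_contra! hne
  obtain ⟨s, hs⟩ := hne
  exact hl.not_isUnit (hS.2.2 _ fun h0 => hs (LinearMap.congr_fun h0 s))

theorem annihilatedBy_of_eta_le {I J : TwoSidedIdeal A} (h : eta I ≤ eta J)
    {S : ModuleCat.{u} A} (hS : IsBrick A S) (hJ : AnnihilatedBy J S) : AnnihilatedBy I S := by
  by_contra hI
  have hrel : (eta I).r (TorsionClass.surjectiveOrZero S) (TorsionClass.leftPerp S) := by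
    intro M hM
    refine ⟨fun h => ⟨h.1, fun f => ?_⟩, fun h => ⟨h.1, fun f hf => absurd (h.2 f) hf⟩⟩
    by_contra hf
    exact hI (hM.of_surjective f (h.2 f hf))
  have hmem : S ∈ (TorsionClass.surjectiveOrZero S).carrier :=
    ⟨hS.1, fun f hf => ((Module.End.isUnit_iff f).1 (hS.2.2 f hf)).surjective⟩
  have hid : (LinearMap.id : Module.End A S) = 0 :=
    ((eta_le_eta_iff.1 h _ _ hrel S hJ).1 hmem).2 LinearMap.id
  have := hS.2.1
  exact one_ne_zero hid

end IsBrick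

/-- The intersection of the annihilators of the bricks over `A ⧸ J`; for `J = ⊥` it is the ideal
`brickIdeal A`. -/
def brickRadical (J : TwoSidedIdeal A) : TwoSidedIdeal A :=
  TwoSidedIdeal.mk' {a | ∀ S : ModuleCat.{u} A, IsBrick A S → AnnihilatedBy J S →
      ∀ s : S, a • s = 0}
    (fun _ _ _ s => zero_smul A s)
    (fun hx hy S hS hJ s => by rw [add_smul, hx S hS hJ s, hy S hS hJ s, add_zero])
    (fun hx S hS hJ s => by rw [neg_smul, hx S hS hJ s, neg_zero])
    (fun hy S hS hJ s => by rw [mul_smul, hy S hS hJ s, smul_zero])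
    (fun hx S hS hJ s => by rw [mul_smul, hx S hS hJ])

theorem le_brickRadical_iff {I J : TwoSidedIdeal A} :
    I ≤ brickRadical J ↔
      ∀ S : ModuleCat.{u} A, IsBrick A S → AnnihilatedBy J S → AnnihilatedBy I S :=
  ⟨fun h S hS hJ _ ha => (TwoSidedIdeal.mem_mk' ..).1 (h ha) S hS hJ,
    fun h _ ha => (TwoSidedIdeal.mem_mk' ..).2 fun S hS hJ => h S hS hJ _ ha⟩

theorem brickRadical_bot : brickRadical (⊥ : TwoSidedIdeal A) = brickIdeal A := by
  have hbot (S : ModuleCat.{u} A) : AnnihilatedBy ⊥ S := fun a ha s => by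
    rw [(TwoSidedIdeal.mem_bot A).1 ha, zero_smul]
  ext a
  simp only [brickRadical, brickIdeal, TwoSidedIdeal.mem_mk', Set.mem_ofPred_eq, hbot, true_imp_iff]

theorem sup_span_singleton_le_brickRadical {c : A} (hc : c ∈ Set.center A) (hnil : IsNilpotent c)
    (J : TwoSidedIdeal A) : J ⊔ .span {c} ≤ brickRadical J :=
  le_brickRadical_iff.2 fun _ hS hJ =>
    annihilatedBy_sup_iff.2 ⟨hJ, hS.annihilatedBy_span_singleton hc hnil⟩

theorem le_brickRadical_of_eta_le {I J : TwoSidedIdeal A} (h : eta I ≤ eta J) :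
    I ≤ brickRadical J :=
  le_brickRadical_iff.2 fun _ hS => hS.annihilatedBy_of_eta_le h

end Eta

/-! ### Path algebras -/

namespace PathAlgebra

open Quiver

variable (k : Type u) [Field k] {V : Type} [Quiver.{0} V] [Fintype V]

theorem vertex_mul_self (i : V) : vertex k i * vertex k i = vertex k i := by
  simp only [vertex, ← map_mul]
  rw [RingQuot.mkAlgHom_rel k (Rel.idem i)]

theorem vertex_mul_vertex_of_ne {i j : V} (h : i ≠ j) : vertex k i * vertex k j = 0 := by
  simp only [vertex, ← map_mul]
  rw [RingQuot.mkAlgHom_rel k (Rel.orth i j h), map_zero]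

variable (V) in
theorem sum_vertex : ∑ i : V, vertex k i = 1 := by
  simp only [vertex, ← map_sum]
  rw [RingQuot.mkAlgHom_rel k Rel.sum_eq_one, map_one]

theorem vertex_mul_arrow {i j : V} (a : i ⟶ j) : vertex k i * arrow k a = arrow k a := by
  simp only [vertex, arrow, ← map_mul]
  rw [RingQuot.mkAlgHom_rel k (Rel.source a)]

theorem arrow_mul_vertex {i j : V} (a : i ⟶ j) : arrow k a * vertex k j = arrow k a := by
  simp only [vertex, arrow, ← map_mul]
  rw [RingQuot.mkAlgHom_rel k (Rel.target a)]

theorem vertex_mul_ofPath {i j : V} (p : Path i j) : vertex k i * ofPath k p = ofPath k p := by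
  induction p with
  | nil => exact vertex_mul_self k i
  | cons p a ih => rw [ofPath, ← mul_assoc, ih]

theorem ofPath_mul_vertex {i j : V} (p : Path i j) : ofPath k p * vertex k j = ofPath k p := by
  cases p with
  | nil => exact vertex_mul_self k i
  | cons p a => rw [ofPath, mul_assoc, arrow_mul_vertex]

theorem ofPath_comp {i j l : V} (p : Path i j) (q : Path j l) :
    ofPath k (p.comp q) = ofPath k p * ofPath k q := by
  induction q with
  | nil => exact (ofPath_mul_vertex k p).symm
  | cons q a ih => rw [Path.comp_cons, ofPath, ofPath, ih, mul_assoc]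

theorem ofPath_mul_ofPath_of_ne {i j l m : V} (p : Path i j) (q : Path l m) (h : j ≠ l) :
    ofPath k p * ofPath k q = 0 := by
  rw [← ofPath_mul_vertex, ← vertex_mul_ofPath k q, mul_assoc, ← mul_assoc (vertex k j),
    vertex_mul_vertex_of_ne k h, zero_mul, mul_zero]

theorem ofPath_toPath {i j : V} (a : i ⟶ j) : ofPath k a.toPath = arrow k a :=
  vertex_mul_arrow k a

variable (V) in
theorem span_range_ofPath :
    Submodule.span k (Set.range fun p : Σ i j : V, Path i j => ofPath k p.2.2) = ⊤ := by
  set W : Set (PathAlgebra k V) := Set.range fun p : Σ i j : V, Path i j => ofPath k p.2.2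
  have mem_W {i j : V} (p : Path i j) : ofPath k p ∈ Submodule.span k W :=
    Submodule.subset_span ⟨⟨i, j, p⟩, rfl⟩
  have one_mem : (1 : PathAlgebra k V) ∈ Submodule.span k W := by
    rw [← sum_vertex]
    exact Submodule.sum_mem _ fun i _ => mem_W (Path.nil : Path i i)
  have mul_le : Submodule.span k W * Submodule.span k W ≤ Submodule.span k W := by
    rw [Submodule.span_mul_span, Submodule.span_le]
    rintro _ ⟨_, ⟨⟨i, j, p⟩, rfl⟩, _, ⟨⟨l, m, q⟩, rfl⟩, rfl⟩
    change ofPath k p * ofPath k q ∈ Submodule.span k W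
    obtain rfl | h := eq_or_ne j l
    · exact ofPath_comp k p q ▸ mem_W (p.comp q)
    · exact ofPath_mul_ofPath_of_ne k p q h ▸ Submodule.zero_mem _
  let S := (Submodule.span k W).toSubalgebra one_mem fun x y hx hy =>
    mul_le (Submodule.mul_mem_mul hx hy)
  suffices ∀ x, x ∈ S from eq_top_iff.2 fun x _ => this x
  intro x
  obtain ⟨z, rfl⟩ := RingQuot.mkAlgHom_surjective k _ x
  induction z using FreeAlgebra.induction with
  | grade0 r => simpa only [AlgHom.commutes] using S.algebraMap_mem r
  | grade1 g =>
    cases g with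
    | vertex i => exact mem_W (Path.nil : Path i i)
    | arrow a => exact (ofPath_toPath k a).subst (motive := (· ∈ S)) (mem_W a.toPath)
  | mul y z hy hz => simpa only [map_mul] using S.mul_mem hy hz
  | add y z hy hz => simpa only [map_add] using S.add_mem hy hz

section Lift

variable {k} {B : Type*} [Ring B] [Algebra k B] (e : V → B) (f : ∀ {i j : V}, (i ⟶ j) → B)
  (idem : ∀ i, e i * e i = e i) (orth : ∀ i j, i ≠ j → e i * e j = 0) (sum : ∑ i, e i = 1)
  (source : ∀ (i j : V) (a : i ⟶ j), e i * f a = f a)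
  (target : ∀ (i j : V) (a : i ⟶ j), f a * e j = f a)

/-- The universal property of the path algebra: a complete system of orthogonal idempotents `e i`
and elements `f a ∈ e i * B * e j` for the arrows `a : i ⟶ j` determine an algebra morphism. -/
noncomputable def lift : PathAlgebra k V →ₐ[k] B :=
  RingQuot.liftAlgHom k ⟨FreeAlgebra.lift k fun | .vertex i => e i | .arrow a => f a, by
    rintro _ _ (i | ⟨i, j, h⟩ | _ | a | a) <;>
      simp only [map_mul, map_sum, map_zero, map_one, FreeAlgebra.lift_ι_apply]
    exacts [idem i, orth i j h, sum, source _ _ a, target _ _ a]⟩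

@[simp]
theorem lift_vertex (i : V) : lift e f idem orth sum source target (vertex k i) = e i := by
  rw [lift, vertex, RingQuot.liftAlgHom_mkAlgHom_apply, FreeAlgebra.lift_ι_apply]

@[simp]
theorem lift_arrow {i j : V} (a : i ⟶ j) :
    lift e f idem orth sum source target (arrow k a) = f a := by
  rw [lift, arrow, RingQuot.liftAlgHom_mkAlgHom_apply, FreeAlgebra.lift_ι_apply]

end Lift

end PathAlgebra

/-! ### Paths in the double quiver of type `A` -/

namespace TypeA

open Quiver

variable {n : ℕ}

instance instDecidableEqSymmetrify : DecidableEq (Symmetrify (TypeA n)) :=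
  inferInstanceAs (DecidableEq (Fin n))

/-- The number of a vertex of the double quiver. -/
def height (i : Symmetrify (TypeA n)) : ℕ := TypeA.val (n := n) i

theorem height_injective : Function.Injective (height (n := n)) := fun _ _ => Fin.ext

theorem height_lt (i : Symmetrify (TypeA n)) : height i < n := Fin.isLt (n := n) i

theorem exists_height_eq {m : ℕ} (h : m < n) : ∃ i : Symmetrify (TypeA n), height i = m :=
  ⟨(⟨m, h⟩ : Fin n), rfl⟩

/-- The distance between two vertices of the double quiver. -/
def vertexDist (i j : Symmetrify (TypeA n)) : ℕ := Nat.dist (height i) (height j)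

theorem vertexDist_def (i j : Symmetrify (TypeA n)) :
    vertexDist i j = height i - height j + (height j - height i) := rfl

theorem height_arrow {i j : Symmetrify (TypeA n)} (a : i ⟶ j) :
    height i + 1 = height j ∨ height j + 1 = height i := by
  rcases a with ⟨⟨h⟩⟩ | ⟨⟨h⟩⟩
  exacts [Or.inl h, Or.inr h]

theorem nonempty_arrow {i j : Symmetrify (TypeA n)}
    (h : height i + 1 = height j ∨ height j + 1 = height i) : Nonempty (i ⟶ j) := by
  rcases h with h | h
  exacts [⟨Sum.inl ⟨h⟩⟩, ⟨Sum.inr ⟨h⟩⟩]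

instance instSubsingletonArrow (i j : Symmetrify (TypeA n)) : Subsingleton (i ⟶ j) := by
  constructor
  rintro (⟨⟨h⟩⟩ | ⟨⟨h⟩⟩) (⟨⟨h'⟩⟩ | ⟨⟨h'⟩⟩)
  exacts [rfl, absurd h (by omega), absurd h (by omega), rfl]

theorem vertexDist_le_length {i j : Symmetrify (TypeA n)} (p : Path i j) :
    vertexDist i j ≤ p.length := by
  induction p with
  | nil => simp [vertexDist_def]
  | cons p a ih =>
    have := height_arrow a
    simp only [vertexDist_def, Path.length_cons] at *
    omega

theorem mem_vertices_iff {i j : Symmetrify (TypeA n)} (p : Path i j) (h : p.length = vertexDist i j)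
    (v : Symmetrify (TypeA n)) :
    v ∈ p.vertices ↔ vertexDist i v + vertexDist v j = vertexDist i j := by
  induction p with
  | nil =>
    rw [Path.vertices_nil, List.mem_singleton, ← height_injective.eq_iff]
    simp only [vertexDist_def]
    omega
  | cons p a ih =>
    have ha := height_arrow a
    have hp := vertexDist_le_length p
    rw [Path.length_cons] at h
    rw [Path.vertices_cons, List.concat_eq_append, List.mem_append, List.mem_singleton,
      ih (by simp only [vertexDist_def] at *; omega), ← height_injective.eq_iff]
    simp only [vertexDist_def] at *
    omega

theorem nodup_vertices_iff {i j : Symmetrify (TypeA n)} (p : Path i j) :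
    p.vertices.Nodup ↔ p.length = vertexDist i j := by
  induction p with
  | nil => simp [vertexDist_def]
  | cons p a ih =>
    have ha := height_arrow a
    have hp := vertexDist_le_length p
    rw [Path.vertices_cons, List.nodup_concat, ih, Path.length_cons]
    constructor
    · rintro ⟨h, h'⟩
      rw [mem_vertices_iff p h'] at h
      simp only [vertexDist_def] at *
      omega
    · intro h
      have h' := le_antisymm (show p.length ≤ _ by simp only [vertexDist_def] at *; omega) hp
      rw [mem_vertices_iff p h']
      simp only [vertexDist_def] at *
      omega

theorem path_eq_of_length_eq {i j : Symmetrify (TypeA n)} (p q : Path i j)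
    (hp : p.length = vertexDist i j) (hq : q.length = vertexDist i j) : p = q := by
  induction p with
  | nil =>
    refine (Path.eq_nil_of_length_zero q ?_).symm
    rw [hq, vertexDist_def]
    omega
  | @cons b c p a ih =>
    cases q with
    | nil =>
      rw [Path.length_nil] at hq
      rw [← hq, Path.length_cons] at hp
      omega
    | @cons b' _ q a' =>
      have ha := height_arrow a
      have ha' := height_arrow a'
      have hp' := vertexDist_le_length p
      have hq' := vertexDist_le_length q
      rw [Path.length_cons] at hp hq
      obtain rfl : b = b' := height_injective (by simp only [vertexDist_def] at *; omega)
      obtain rfl := Subsingleton.elim a a'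
      rw [ih q (by simp only [vertexDist_def] at *; omega)
        (by simp only [vertexDist_def] at *; omega)]

theorem sum_hom_eq_single {M : Type*} [AddCommMonoid M] (F : ∀ i j : TypeA n, (i ⟶ j) → M)
    {x y : TypeA n} (a : x ⟶ y)
    (hF : ∀ (i j : TypeA n) (b : i ⟶ j), i ≠ x → j ≠ y → F i j b = 0) :
    ∑ i : TypeA n, ∑ j : TypeA n, ∑ b : i ⟶ j, F i j b = F x y a := by
  have ha : x.val + 1 = y.val := a.down
  have target_ne {i j : TypeA n} (b : i ⟶ j) (hi : i ≠ x) : j ≠ y := by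
    rintro rfl
    have hb : i.val + 1 = j.val := b.down
    exact hi (Fin.ext (show i.val = x.val by omega))
  have target_eq {j : TypeA n} (b : x ⟶ j) : j = y := by
    have hb : x.val + 1 = j.val := b.down
    exact Fin.ext (show j.val = y.val by omega)
  have : Subsingleton (x ⟶ y) := inferInstanceAs (Subsingleton (PLift _))
  rw [Fintype.sum_eq_single x, Fintype.sum_eq_single y, Fintype.sum_subsingleton _ a]
  · exact fun j hj => Finset.sum_eq_zero fun b _ => absurd (target_eq b) hj
  · exact fun i hi => Finset.sum_eq_zero fun j _ => Finset.sum_eq_zero fun b _ =>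
      hF i j b hi (target_ne b hi)

theorem exists_path_length_eq (i j : Symmetrify (TypeA n)) :
    ∃ p : Path i j, p.length = vertexDist i j := by
  generalize hd : vertexDist i j = d
  induction d generalizing j with
  | zero =>
    obtain rfl : i = j := height_injective (by rw [vertexDist_def] at hd; omega)
    exact ⟨Path.nil, rfl⟩
  | succ d ih =>
    have hi := height_lt i
    have hj := height_lt j
    obtain ⟨j', hj', hd'⟩ : ∃ j' : Symmetrify (TypeA n),
        (height j' + 1 = height j ∨ height j + 1 = height j') ∧ vertexDist i j' = d := by
      rw [vertexDist_def] at hd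
      rcases lt_or_ge (height i) (height j) with h | h
      · obtain ⟨j', hj'⟩ := exists_height_eq (n := n) (m := height j - 1) (by omega)
        exact ⟨j', by omega, by rw [vertexDist_def]; omega⟩
      · obtain ⟨j', hj'⟩ := exists_height_eq (n := n) (m := height j + 1) (by omega)
        exact ⟨j', by omega, by rw [vertexDist_def]; omega⟩
    obtain ⟨p, hp⟩ := ih j' hd'
    obtain ⟨a⟩ := nonempty_arrow hj'
    exact ⟨p.cons a, by rw [Path.length_cons, hp]⟩

/-- The shortest path between two vertices. -/
noncomputable def geodesic (i j : Symmetrify (TypeA n)) : Path i j :=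
  (exists_path_length_eq i j).choose

theorem length_geodesic (i j : Symmetrify (TypeA n)) : (geodesic i j).length = vertexDist i j :=
  (exists_path_length_eq i j).choose_spec

theorem eq_geodesic {i j : Symmetrify (TypeA n)} (p : Path i j) (hp : p.length = vertexDist i j) :
    p = geodesic i j :=
  path_eq_of_length_eq p _ hp (length_geodesic i j)

theorem geodesic_self (i : Symmetrify (TypeA n)) : geodesic i i = Path.nil :=
  (eq_geodesic Path.nil (by simp [vertexDist_def])).symm

/-- The shortest path between two vertices, as a non-revisiting path. -/
noncomputable def geodesicPath (i j : Symmetrify (TypeA n)) : PathsA n :=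
  ⟨i, j, geodesic i j, (nodup_vertices_iff _).2 (length_geodesic i j)⟩

theorem eq_geodesicPath (p : PathsA n) : p = geodesicPath p.source p.target := by
  obtain ⟨i, j, p, hp⟩ := p
  obtain rfl := eq_geodesic p ((nodup_vertices_iff p).1 hp)
  rfl

/-- The shortest path from `i` to `j` passes through `a` and then through `b`. -/
def Passes (i j a b : Symmetrify (TypeA n)) : Prop :=
  vertexDist i a + vertexDist a b + vertexDist b j = vertexDist i j

instance instDecidablePasses (i j a b : Symmetrify (TypeA n)) : Decidable (Passes i j a b) :=
  inferInstanceAs (Decidable (_ = _))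

theorem Passes.left {i j a b : Symmetrify (TypeA n)} (h : Passes i j a b) : Passes i j a a := by
  simp only [Passes, vertexDist_def] at *
  omega

theorem Passes.right {i j a b : Symmetrify (TypeA n)} (h : Passes i j a b) : Passes i j b b := by
  simp only [Passes, vertexDist_def] at *
  omega

theorem passes_self (i j : Symmetrify (TypeA n)) : Passes i j i j := by
  simp [Passes, vertexDist_def]

theorem geodesicPath_le_iff {i j a b : Symmetrify (TypeA n)} :
    geodesicPath a b ≤ geodesicPath i j ↔ Passes i j a b := by
  constructor
  · rintro ⟨q, r, h⟩
    have key (q : Path i a) (r : Path b j)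
        (h : geodesic i j = Path.comp q (Path.comp (geodesic a b) r)) : Passes i j a b := by
      have hlen := congrArg Path.length h
      rw [Path.length_comp, Path.length_comp, length_geodesic, length_geodesic] at hlen
      have hq := vertexDist_le_length q
      have hr := vertexDist_le_length r
      simp only [Passes, vertexDist_def] at *
      omega
    exact key q r h
  · intro h
    refine ⟨geodesic i a, geodesic b j, (eq_geodesic _ ?_).symm⟩
    change (Path.comp (geodesic i a) (Path.comp (geodesic a b) (geodesic b j))).length = _
    rw [Path.length_comp, Path.length_comp, length_geodesic, length_geodesic, length_geodesic,
      ← add_assoc]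
    exact h

end TypeA

/-! ### The central element of the preprojective algebra -/

namespace PiA

open Quiver TypeA

variable (k : Type u) [Field k] {n : ℕ}

/-- The element of `Π` given by an arbitrary path of the double quiver. -/
noncomputable def word {i j : Symmetrify (TypeA n)} (p : Path i j) : PiA k n :=
  RingQuot.mkAlgHom k (PreprojRel k (TypeA n)) (PathAlgebra.ofPath k p)

/-- The idempotent `e_i` of `Π`. -/
noncomputable abbrev vertex (i : Symmetrify (TypeA n)) : PiA k n := word k (Path.nil : Path i i)

theorem word_toPath {i j : Symmetrify (TypeA n)} (a : i ⟶ j) : word k a.toPath = arrow k n a :=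
  congrArg _ (PathAlgebra.ofPath_toPath k a)

theorem word_cons {i j l : Symmetrify (TypeA n)} (p : Path i j) (a : j ⟶ l) :
    word k (p.cons a) = word k p * arrow k n a :=
  map_mul _ _ _

theorem word_comp {i j l : Symmetrify (TypeA n)} (p : Path i j) (q : Path j l) :
    word k (p.comp q) = word k p * word k q := by
  rw [word, PathAlgebra.ofPath_comp, map_mul, word, word]

theorem word_mul_word_of_ne {i j l m : Symmetrify (TypeA n)} (p : Path i j) (q : Path l m)
    (h : j ≠ l) : word k p * word k q = 0 := by
  rw [word, word, ← map_mul, PathAlgebra.ofPath_mul_ofPath_of_ne k p q h, map_zero]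

theorem vertex_mul_word {i j : Symmetrify (TypeA n)} (p : Path i j) :
    vertex k i * word k p = word k p := by
  rw [← word_comp, Path.nil_comp]

theorem word_mul_vertex {i j : Symmetrify (TypeA n)} (p : Path i j) :
    word k p * vertex k j = word k p := by
  rw [← word_comp, Path.comp_nil]

theorem vertex_mul_arrow_mul_arrow {i j : Symmetrify (TypeA n)} (a : i ⟶ j) (b : j ⟶ i) :
    vertex k i * (arrow k n a * arrow k n b) = arrow k n a * arrow k n b := by
  rw [← mul_assoc, ← word_toPath k a, vertex_mul_word]

theorem vertex_mul_arrow_mul_arrow_of_ne {x i j : Symmetrify (TypeA n)} (a : i ⟶ j) (b : j ⟶ i)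
    (h : x ≠ i) : vertex k x * (arrow k n a * arrow k n b) = 0 := by
  rw [← mul_assoc, ← word_toPath k a, word_mul_word_of_ne k _ _ h, zero_mul]

theorem vertex_mul_arrow_mul_arrow_comm (x : Symmetrify (TypeA n)) {i j : Symmetrify (TypeA n)}
    (a : i ⟶ j) (b : j ⟶ i) :
    vertex k x * (arrow k n a * arrow k n b) = arrow k n a * arrow k n b * vertex k x := by
  rw [← word_toPath k a, ← word_cons]
  obtain rfl | h := eq_or_ne x i
  · rw [vertex_mul_word, word_mul_vertex]
  · rw [word_mul_word_of_ne k _ _ h, word_mul_word_of_ne k _ _ h.symm]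

variable (n) in
theorem sum_vertex : ∑ i : Symmetrify (TypeA n), vertex k i = 1 :=
  (map_sum _ _ _).symm.trans
    ((congrArg _ (PathAlgebra.sum_vertex k (Symmetrify (TypeA n)))).trans (map_one _))

theorem sum_vertex_mul_mul_vertex (x : PiA k n) :
    ∑ i : Symmetrify (TypeA n), ∑ j : Symmetrify (TypeA n), vertex k i * x * vertex k j = x := by
  simp only [← Finset.mul_sum, ← Finset.sum_mul, sum_vertex, one_mul, mul_one]

variable (n) in
theorem span_range_word :
    Submodule.span k (Set.range fun p : Σ i j : Symmetrify (TypeA n), Path i j => word k p.2.2) =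
      ⊤ := by
  let π := (RingQuot.mkAlgHom k (PreprojRel k (TypeA n))).toLinearMap
  have hπ : LinearMap.range π = ⊤ := LinearMap.range_eq_top.2 (RingQuot.mkAlgHom_surjective k _)
  rw [← hπ, LinearMap.range_eq_map, ← PathAlgebra.span_range_ofPath, Submodule.map_span,
    ← Set.range_comp]
  rfl

variable (n) in
/-- The sum of the 2-cycles `a a*`, where `a` runs over the arrows of `A_n`. -/
noncomputable def central : PiA k n :=
  ∑ i : TypeA n, ∑ j : TypeA n, ∑ a : i ⟶ j, arrow k n a.toPos * arrow k n a.toNeg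

variable (n) in
theorem central_eq_sum_toNeg_mul_toPos : central k n =
    ∑ i : TypeA n, ∑ j : TypeA n, ∑ a : i ⟶ j, arrow k n a.toNeg * arrow k n a.toPos := by
  have h := RingQuot.mkAlgHom_rel k (PreprojRel.rel (k := k) (V := TypeA n))
  rw [map_zero] at h
  simp only [map_sum, map_sub, map_mul, Finset.sum_sub_distrib] at h
  exact sub_eq_zero.1 h

theorem arrow_mul_arrow {i j : Symmetrify (TypeA n)} (a : i ⟶ j) (b : j ⟶ i) :
    arrow k n a * arrow k n b = vertex k i * central k n := by
  rcases a with a | a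
  · obtain rfl : b = Sum.inr a := Subsingleton.elim _ _
    rw [central]
    simp only [Finset.mul_sum]
    exact ((sum_hom_eq_single (fun l m (c : l ⟶ m) =>
      vertex k i * (arrow k n c.toPos * arrow k n c.toNeg)) a
      fun l m c hl _ => vertex_mul_arrow_mul_arrow_of_ne k _ _ hl.symm).trans
      (vertex_mul_arrow_mul_arrow k _ _)).symm
  · obtain rfl : b = Sum.inl a := Subsingleton.elim _ _
    rw [central_eq_sum_toNeg_mul_toPos]
    simp only [Finset.mul_sum]
    exact ((sum_hom_eq_single (fun l m (c : l ⟶ m) =>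
      vertex k i * (arrow k n c.toNeg * arrow k n c.toPos)) a
      fun l m c _ hm => vertex_mul_arrow_mul_arrow_of_ne k _ _ hm.symm).trans
      (vertex_mul_arrow_mul_arrow k _ _)).symm

theorem vertex_mul_central_of_height_eq_zero {i : Symmetrify (TypeA n)} (hi : height i = 0) :
    vertex k i * central k n = 0 := by
  rw [central_eq_sum_toNeg_mul_toPos]
  simp only [Finset.mul_sum]
  refine Finset.sum_eq_zero fun x _ => Finset.sum_eq_zero fun y _ => Finset.sum_eq_zero fun a _ =>
    vertex_mul_arrow_mul_arrow_of_ne k _ _ ?_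
  rintro rfl
  have ha : x.val + 1 = height i := a.down
  omega

theorem vertex_mul_central (i : Symmetrify (TypeA n)) :
    vertex k i * central k n = central k n * vertex k i := by
  rw [central]
  simp only [Finset.mul_sum, Finset.sum_mul]
  exact Finset.sum_congr rfl fun x _ => Finset.sum_congr rfl fun y _ =>
    Finset.sum_congr rfl fun a _ => vertex_mul_arrow_mul_arrow_comm k i _ _

theorem word_mul_central {i j : Symmetrify (TypeA n)} (p : Path i j) :
    word k p * central k n = central k n * word k p := by
  induction p with
  | nil => exact vertex_mul_central k i
  | @cons j l p a ih =>
    obtain ⟨b⟩ := nonempty_arrow (height_arrow a).symm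
    have harrow : arrow k n a * central k n = vertex k j * central k n * arrow k n a := by
      rw [← arrow_mul_arrow k a b, mul_assoc, arrow_mul_arrow k b a, ← mul_assoc,
        ← word_toPath k a, word_mul_vertex]
    rw [word_cons, mul_assoc, harrow, ← mul_assoc, ← mul_assoc, word_mul_vertex, ih, mul_assoc]

variable (n) in
theorem central_mem_center : central k n ∈ Set.center (PiA k n) := by
  refine Semigroup.mem_center_iff.2 fun x => ?_
  induction (span_range_word k n).ge (Submodule.mem_top (x := x)) using
    Submodule.span_induction with
  | mem _ hw =>
    obtain ⟨p, rfl⟩ := hw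
    exact word_mul_central k p.2.2
  | zero => rw [zero_mul, mul_zero]
  | add x y _ _ hx hy => rw [add_mul, mul_add, hx, hy]
  | smul r x _ hx => rw [smul_mul_assoc, mul_smul_comm, hx]

theorem commute_central (x : PiA k n) : Commute (central k n) x :=
  (Set.mem_center_iff.1 (central_mem_center k n)).comm x

theorem vertex_mul_central_pow (i : Symmetrify (TypeA n)) :
    vertex k i * central k n ^ (height i + 1) = 0 := by
  generalize hm : height i = m
  induction m generalizing i with
  | zero => rw [zero_add, pow_one, vertex_mul_central_of_height_eq_zero k hm]
  | succ m ih =>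
    have hi := height_lt i
    obtain ⟨j, hj⟩ := exists_height_eq (n := n) (m := m) (by omega)
    obtain ⟨a⟩ := nonempty_arrow (i := i) (j := j) (by omega)
    obtain ⟨b⟩ := nonempty_arrow (i := j) (j := i) (by omega)
    calc vertex k i * central k n ^ (m + 1 + 1)
        = arrow k n a * (arrow k n b * central k n ^ (m + 1)) := by
          rw [pow_succ', ← mul_assoc, ← arrow_mul_arrow k a b, mul_assoc]
      _ = arrow k n a * (vertex k j * central k n ^ (m + 1) * arrow k n b) := by
          rw [mul_assoc (vertex k j), ((commute_central k _).pow_left _).eq,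
            ← mul_assoc (vertex k j), ← word_toPath k b, vertex_mul_word]
      _ = 0 := by rw [ih j hj, zero_mul, mul_zero]

variable (n) in
theorem isNilpotent_central : IsNilpotent (central k n) := by
  refine ⟨n, ?_⟩
  rw [← one_mul (central k n ^ n), ← sum_vertex, Finset.sum_mul]
  refine Finset.sum_eq_zero fun i _ => ?_
  rw [← pow_mul_pow_sub _ (Nat.succ_le_of_lt (height_lt i)), ← mul_assoc, vertex_mul_central_pow,
    zero_mul]

variable (n) in
theorem cycIdeal_eq_span_central : cycIdeal k n = TwoSidedIdeal.span {central k n} := by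
  refine le_antisymm (TwoSidedIdeal.span_le.2 ?_)
    (TwoSidedIdeal.span_le.2 (Set.singleton_subset_iff.2 ?_))
  · rintro _ ⟨i, j, a, b, rfl⟩
    rw [arrow_mul_arrow]
    exact TwoSidedIdeal.mul_mem_left _ _ _ (TwoSidedIdeal.subset_span rfl)
  · exact sum_mem fun _ _ => sum_mem fun _ _ => sum_mem fun a _ =>
      TwoSidedIdeal.subset_span ⟨_, _, a.toPos, a.toNeg, rfl⟩

variable (n) in
theorem central_mem_cycIdeal : central k n ∈ cycIdeal k n :=
  (cycIdeal_eq_span_central k n).ge (TwoSidedIdeal.subset_span rfl)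

theorem exists_word_eq {i j : Symmetrify (TypeA n)} (p : Path i j) :
    ∃ m, word k p = word k (geodesic i j) * central k n ^ m := by
  induction p with
  | nil => exact ⟨0, by rw [geodesic_self, pow_zero, mul_one]⟩
  | @cons j l p a ih =>
    obtain ⟨m, hm⟩ := ih
    have ha := height_arrow a
    have hcons : word k (p.cons a) = word k ((geodesic i j).cons a) * central k n ^ m := by
      rw [word_cons, word_cons, hm, mul_assoc, ((commute_central k _).pow_left _).eq, ← mul_assoc]
    rw [hcons]
    by_cases h : vertexDist i l = vertexDist i j + 1
    · refine ⟨m, ?_⟩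
      rw [eq_geodesic ((geodesic i j).cons a) (by rw [Path.length_cons, length_geodesic, h])]
    · have h' : vertexDist i l + 1 = vertexDist i j := by
        simp only [vertexDist_def] at *
        omega
      obtain ⟨b⟩ := nonempty_arrow ha.symm
      refine ⟨m + 1, ?_⟩
      rw [← eq_geodesic ((geodesic i l).cons b) (by rw [Path.length_cons, length_geodesic, h']),
        word_cons, word_cons, mul_assoc (word k _), arrow_mul_arrow, ← mul_assoc (word k _),
        word_mul_vertex, pow_succ', mul_assoc]

theorem ofPath_eq (p : PathsA n) : ofPath k n p = word k (geodesic p.source p.target) := by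
  rw [← eq_geodesic p.path ((nodup_vertices_iff _).1 p.nodup)]
  rfl

theorem ofPath_mem_of_le {I : TwoSidedIdeal (PiA k n)} {p q : PathsA n} (h : p ≤ q)
    (hp : ofPath k n p ∈ I) : ofPath k n q ∈ I := by
  obtain ⟨b, c, hq⟩ := h
  change word k q.path ∈ I
  rw [hq, word_comp, word_comp]
  exact I.mul_mem_left _ _ (I.mul_mem_right _ _ hp)

section Corners

open Polynomial

theorem exists_vertex_mul_mul_vertex_eq (i j : Symmetrify (TypeA n)) (x : PiA k n) :
    ∃ q : k[X], vertex k i * x * vertex k j = word k (geodesic i j) * aeval (central k n) q := by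
  induction (span_range_word k n).ge (Submodule.mem_top (x := x)) using
    Submodule.span_induction with
  | mem _ hw =>
    obtain ⟨⟨a, b, p⟩, rfl⟩ := hw
    dsimp only
    obtain rfl | ha := eq_or_ne i a
    · obtain rfl | hb := eq_or_ne b j
      · obtain ⟨m, hm⟩ := exists_word_eq k p
        exact ⟨X ^ m, by rw [vertex_mul_word, word_mul_vertex, hm, map_pow, aeval_X]⟩
      · exact ⟨0, by rw [mul_assoc, word_mul_word_of_ne k p _ hb, map_zero, mul_zero, mul_zero]⟩
    · exact ⟨0, by rw [word_mul_word_of_ne k _ p ha, map_zero, mul_zero, zero_mul]⟩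
  | zero => exact ⟨0, by rw [map_zero, mul_zero, mul_zero, zero_mul]⟩
  | add x y _ _ hx hy =>
    obtain ⟨q, hq⟩ := hx
    obtain ⟨r, hr⟩ := hy
    exact ⟨q + r, by rw [mul_add, add_mul, hq, hr, map_add, mul_add]⟩
  | smul r x _ hx =>
    obtain ⟨q, hq⟩ := hx
    exact ⟨r • q, by rw [mul_smul_comm, smul_mul_assoc, hq, map_smul, mul_smul_comm]⟩

theorem word_mem_of_word_mul_aeval_mem {I : TwoSidedIdeal (PiA k n)} {i j : Symmetrify (TypeA n)}
    {p : Path i j} {q : k[X]} (hq : q.coeff 0 ≠ 0)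
    (h : word k p * aeval (central k n) q ∈ I) : word k p ∈ I := by
  obtain ⟨u, hu⟩ := isUnit_aeval_of_isNilpotent (A := PiA k n) (isNilpotent_central k n)
    (isUnit_iff_ne_zero.2 hq)
  rw [← Units.mul_inv_cancel_right (word k p) u, hu]
  exact I.mul_mem_right _ _ h

theorem word_mul_aeval_sub_smul_mem_cycIdeal {i j : Symmetrify (TypeA n)} (p : Path i j)
    (q : k[X]) : word k p * aeval (central k n) q - q.coeff 0 • word k p ∈ cycIdeal k n := by
  have haeval := aeval_eq_mul_aeval_divX_add (A := PiA k n) (central k n) q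
  have hsub : word k p * aeval (central k n) q - q.coeff 0 • word k p =
      word k p * (central k n * aeval (central k n) q.divX) := by
    rw [haeval, mul_add, ← Algebra.commutes, ← Algebra.smul_def]
    exact add_sub_cancel_right (G := PiA k n) _ _
  rw [hsub]
  exact (cycIdeal k n).mul_mem_left _ _
    ((cycIdeal k n).mul_mem_right _ _ (central_mem_cycIdeal k n))

theorem le_of_forall_ofPath_mem {I K : TwoSidedIdeal (PiA k n)} (hK : cycIdeal k n ≤ K)
    (h : ∀ p, ofPath k n p ∈ I → ofPath k n p ∈ K) : I ≤ K := by
  intro x hx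
  rw [← sum_vertex_mul_mul_vertex k x]
  refine sum_mem fun i _ => sum_mem fun j _ => ?_
  have hI : vertex k i * x * vertex k j ∈ I := I.mul_mem_right _ _ (I.mul_mem_left _ _ hx)
  obtain ⟨q, hq⟩ := exists_vertex_mul_mul_vertex_eq k i j x
  rw [hq] at hI ⊢
  by_cases hq0 : q.coeff 0 = 0
  · have hcyc := word_mul_aeval_sub_smul_mem_cycIdeal k (geodesic i j) q
    rw [hq0, zero_smul] at hcyc
    exact hK ((sub_zero (word k (geodesic i j) * aeval (central k n) q)).subst hcyc)
  · exact K.mul_mem_right _ _ (h (geodesicPath i j) (word_mem_of_word_mul_aeval_mem k hq0 hI))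

end Corners

end PiA

/-! ### Uniserial modules -/

namespace PiA

open Quiver TypeA

/-- The vertices of the shortest path from `i` to `j`. -/
abbrev Between {n : ℕ} (i j : Symmetrify (TypeA n)) : Type := {a // Passes i j a a}

variable (k : Type u) [Field k] {n : ℕ} (i j : Symmetrify (TypeA n))

/-- The matrix unit at `(a, b)`, or zero if the shortest path from `i` to `j` does not pass through
`a` and then through `b`. These matrices describe the action of the shortest paths on the uniserial
module with top `j` and socle `i`. -/
def unitMatrix (a b : Symmetrify (TypeA n)) : Matrix (Between i j) (Between i j) k :=
  if h : Passes i j a b then Matrix.single ⟨a, h.left⟩ ⟨b, h.right⟩ 1 else 0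

theorem unitMatrix_eq_zero_iff {a b : Symmetrify (TypeA n)} :
    unitMatrix k i j a b = 0 ↔ ¬ Passes i j a b := by
  rw [unitMatrix]
  split_ifs with h
  · refine iff_of_false (fun h0 => one_ne_zero (α := k) ?_) (not_not_intro h)
    simpa only [Matrix.single_apply_same, Matrix.zero_apply] using
      congrFun₂ h0 ⟨a, h.left⟩ ⟨b, h.right⟩
  · exact iff_of_true rfl h

theorem unitMatrix_mul (a b c : Symmetrify (TypeA n)) :
    unitMatrix k i j a b * unitMatrix k i j b c =
      if vertexDist a b + vertexDist b c = vertexDist a c then unitMatrix k i j a c else 0 := by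
  have passes_iff : Passes i j a b ∧ Passes i j b c ↔
      vertexDist a b + vertexDist b c = vertexDist a c ∧ Passes i j a c := by
    simp only [Passes, vertexDist_def]
    omega
  by_cases h : Passes i j a b ∧ Passes i j b c
  · obtain ⟨hadd, hac⟩ := passes_iff.1 h
    rw [if_pos hadd, unitMatrix, unitMatrix, unitMatrix, dif_pos h.1, dif_pos h.2, dif_pos hac,
      Matrix.single_mul_single_same, one_mul]
  · have hright : (if vertexDist a b + vertexDist b c = vertexDist a c then
        unitMatrix k i j a c else 0) = 0 :=
      ite_eq_right_iff.2 fun hadd => (unitMatrix_eq_zero_iff k i j).2 fun hac =>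
        h (passes_iff.2 ⟨hadd, hac⟩)
    rw [hright]
    obtain h | h := not_and_or.1 h
    · rw [(unitMatrix_eq_zero_iff k i j).2 h, zero_mul]
    · rw [(unitMatrix_eq_zero_iff k i j).2 h, mul_zero]

theorem unitMatrix_mul_of_ne {a b : Symmetrify (TypeA n)} (h : a ≠ b) :
    unitMatrix k i j a a * unitMatrix k i j b b = 0 := by
  unfold unitMatrix
  split_ifs
  · exact Matrix.single_mul_single_of_ne _ _ _ _ (Subtype.coe_ne_coe.1 h) _
  all_goals simp only [mul_zero, zero_mul]

theorem sum_unitMatrix : ∑ a, unitMatrix k i j a a = 1 := by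
  rw [← Matrix.sum_single_one]
  refine (Fintype.sum_of_injective _ Subtype.val_injective _ _ (fun a ha => ?_) fun a => ?_).symm
  · exact (unitMatrix_eq_zero_iff k i j).2 fun h => ha ⟨⟨a, h⟩, rfl⟩
  · rw [unitMatrix, dif_pos a.2]

theorem unitMatrix_mul_unitMatrix_of_arrow {a b : Symmetrify (TypeA n)} (e : a ⟶ b) :
    unitMatrix k i j a b * unitMatrix k i j b a = 0 := by
  have := height_arrow e
  rw [unitMatrix_mul, if_neg]
  simp only [vertexDist_def]
  omega

/-- The representation of the path algebra on the uniserial module with top `j` and socle `i`. -/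
noncomputable def pathRep :
    PathAlgebra k (Symmetrify (TypeA n)) →ₐ[k] Matrix (Between i j) (Between i j) k :=
  PathAlgebra.lift (fun a => unitMatrix k i j a a) (fun {a b} _ => unitMatrix k i j a b)
    (fun a => by rw [unitMatrix_mul, if_pos (by simp [vertexDist_def])])
    (fun _ _ => unitMatrix_mul_of_ne k i j)
    (sum_unitMatrix k i j)
    (fun _ _ _ => by rw [unitMatrix_mul, if_pos (by simp [vertexDist_def])])
    (fun _ _ _ => by rw [unitMatrix_mul, if_pos (by simp [vertexDist_def])])

theorem pathRep_arrow_mul_arrow {a b : Symmetrify (TypeA n)} (e : a ⟶ b) (f : b ⟶ a) :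
    pathRep k i j (PathAlgebra.arrow k e) * pathRep k i j (PathAlgebra.arrow k f) = 0 := by
  rw [pathRep, PathAlgebra.lift_arrow, PathAlgebra.lift_arrow,
    unitMatrix_mul_unitMatrix_of_arrow k i j e]

/-- The representation of `Π` on the uniserial module with top `j` and socle `i`. -/
noncomputable def rep : PiA k n →ₐ[k] Matrix (Between i j) (Between i j) k :=
  RingQuot.liftAlgHom k ⟨pathRep k i j, by
    rintro _ _ ⟨⟩
    simp only [map_sum, map_sub, map_mul, map_zero]
    refine Finset.sum_eq_zero fun a _ => Finset.sum_eq_zero fun b _ =>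
      Finset.sum_eq_zero fun e _ => ?_
    exact (congrArg₂ (· - ·) (pathRep_arrow_mul_arrow k i j e.toPos e.toNeg)
      (pathRep_arrow_mul_arrow k i j e.toNeg e.toPos)).trans (sub_zero 0)⟩

theorem rep_vertex (a : Symmetrify (TypeA n)) :
    rep k i j (vertex k a) = unitMatrix k i j a a :=
  (RingQuot.liftAlgHom_mkAlgHom_apply ..).trans (PathAlgebra.lift_vertex ..)

theorem rep_arrow {a b : Symmetrify (TypeA n)} (e : a ⟶ b) :
    rep k i j (arrow k n e) = unitMatrix k i j a b :=
  (RingQuot.liftAlgHom_mkAlgHom_apply ..).trans (PathAlgebra.lift_arrow ..)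

theorem rep_word {a b : Symmetrify (TypeA n)} (p : Path a b) (hp : p.length = vertexDist a b) :
    rep k i j (word k p) = unitMatrix k i j a b := by
  induction p with
  | nil => exact rep_vertex k i j a
  | @cons b c p e ih =>
    have he := height_arrow e
    have hle := vertexDist_le_length p
    rw [Path.length_cons] at hp
    simp only [vertexDist_def] at *
    rw [word_cons, map_mul, ih (by omega), rep_arrow, unitMatrix_mul, if_pos]
    simp only [vertexDist_def]
    omega

/-- The annihilator of the uniserial module with top `j` and socle `i`. -/
noncomputable def repKer : TwoSidedIdeal (PiA k n) :=
  TwoSidedIdeal.ker (rep k i j : PiA k n →+* Matrix (Between i j) (Between i j) k)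

theorem mem_repKer {x : PiA k n} : x ∈ repKer k i j ↔ rep k i j x = 0 := TwoSidedIdeal.mem_ker _

theorem cycIdeal_le_repKer : cycIdeal k n ≤ repKer k i j := by
  refine TwoSidedIdeal.span_le.2 ?_
  rintro _ ⟨a, b, e, f, rfl⟩
  rw [SetLike.mem_coe, mem_repKer, map_mul, rep_arrow, rep_arrow,
    unitMatrix_mul_unitMatrix_of_arrow k i j e]

theorem ofPath_mem_repKer_iff {q : PathsA n} :
    ofPath k n q ∈ repKer k i j ↔ ¬ q ≤ geodesicPath i j := by
  rw [mem_repKer, ofPath_eq, rep_word k i j _ (length_geodesic _ _),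
    unitMatrix_eq_zero_iff, ← geodesicPath_le_iff, ← eq_geodesicPath]

theorem le_repKer_iff {I : TwoSidedIdeal (PiA k n)} :
    I ≤ repKer k i j ↔ ofPath k n (geodesicPath i j) ∉ I := by
  refine ⟨fun h hI => (ofPath_mem_repKer_iff k i j).1 (h hI) le_rfl, fun h => ?_⟩
  exact le_of_forall_ofPath_mem k (cycIdeal_le_repKer k i j) fun q hq =>
    (ofPath_mem_repKer_iff k i j).2 fun hle => h (ofPath_mem_of_le k hle hq)

/-- The uniserial module with top `j` and socle `i`. -/
def Uniserial : Type u := Between i j → k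

namespace Uniserial

variable {k}

instance instAddCommGroup : AddCommGroup (Uniserial k i j) :=
  inferInstanceAs (AddCommGroup (Between i j → k))

instance instModule : Module k (Uniserial k i j) := inferInstanceAs (Module k (Between i j → k))

instance instNontrivial : Nontrivial (Uniserial k i j) :=
  have : Nonempty (Between i j) := ⟨⟨i, (passes_self i j).left⟩⟩
  inferInstanceAs (Nontrivial (Between i j → k))

noncomputable instance instModulePiA : Module (PiA k n) (Uniserial k i j) :=
  Module.compHom (Between i j → k)
    (Matrix.toLinAlgEquiv'.toAlgHom.comp (rep k i j)).toRingHom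

variable {i j}

theorem smul_def (x : PiA k n) (v : Uniserial k i j) : x • v = (rep k i j x).mulVec v := rfl

instance instIsScalarTower : IsScalarTower k (PiA k n) (Uniserial k i j) where
  smul_assoc r x v := by
    rw [smul_def, map_smul]
    exact Matrix.smul_mulVec r (rep k i j x) v

variable (k) in
/-- The basis vector of the uniserial module at the vertex `a`. -/
def basisVector (a : Between i j) : Uniserial k i j := Pi.single (M := fun _ => k) a 1

theorem sum_smul_basisVector (v : Uniserial k i j) : ∑ a, v a • basisVector k a = v :=
  (pi_eq_sum_univ' (R := k) v).symm

variable (k i j) in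
/-- The basis vector that generates the uniserial module. -/
abbrev top : Uniserial k i j := basisVector k ⟨j, (passes_self i j).right⟩

theorem word_geodesic_smul (a : Between i j) (v : Uniserial k i j) :
    word k (geodesic a.1 j) • v = v ⟨j, (passes_self i j).right⟩ • basisVector k a := by
  have hpass : Passes i j a.1 j := by
    have := a.2
    simp only [Passes, vertexDist_def] at *
    omega
  rw [smul_def, rep_word k i j _ (length_geodesic _ _), unitMatrix, dif_pos hpass]
  exact (Matrix.single_mulVec_eq ..).trans (by rw [one_mul]; rfl)

theorem word_geodesic_smul_top (a : Between i j) :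
    word k (geodesic a.1 j) • top k i j = basisVector k a := by
  rw [word_geodesic_smul, top, basisVector, Pi.single_eq_same, one_smul]

theorem exists_smul_top_eq (v : Uniserial k i j) : ∃ x : PiA k n, x • top k i j = v := by
  refine ⟨∑ a : Between i j, v a • word k (geodesic a.1 j), ?_⟩
  rw [Finset.sum_smul]
  simp only [smul_assoc, word_geodesic_smul_top, sum_smul_basisVector]

instance instFinite : Module.Finite (PiA k n) (Uniserial k i j) :=
  .of_surjective (LinearMap.toSpanSingleton (PiA k n) _ (top k i j)) exists_smul_top_eq

theorem end_apply (f : Module.End (PiA k n) (Uniserial k i j)) (v : Uniserial k i j) :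
    f v = f (top k i j) ⟨j, (passes_self i j).right⟩ • v := by
  have htop : f (top k i j) = f (top k i j) ⟨j, (passes_self i j).right⟩ • top k i j := by
    rw [← word_geodesic_smul, ← map_smul, word_geodesic_smul_top]
  obtain ⟨x, rfl⟩ := exists_smul_top_eq v
  rw [map_smul, smul_comm, ← htop]

variable (k i j) in
theorem isBrick : IsBrick (PiA k n) (ModuleCat.of (PiA k n) (Uniserial k i j)) :=
  .of_forall_end_eq_smul fun f => ⟨_, end_apply f⟩

theorem annihilatedBy_iff {I : TwoSidedIdeal (PiA k n)} :
    AnnihilatedBy I (ModuleCat.of (PiA k n) (Uniserial k i j)) ↔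
      ofPath k n (geodesicPath i j) ∉ I := by
  rw [← le_repKer_iff]
  refine forall₂_congr fun x _ => ?_
  rw [mem_repKer, Matrix.ext_iff_mulVec]
  exact forall_congr' fun v => (Matrix.zero_mulVec v).symm ▸ Iff.rfl

end Uniserial

end PiA

/-! ### Ideals of the preprojective algebra -/

namespace PiA

open Quiver TypeA

section

variable {k : Type u} [Field k] {n : ℕ} {I J : TwoSidedIdeal (PiA k n)}

theorem ofPath_mem_sup_cycIdeal_iff {p : PathsA n} :
    ofPath k n p ∈ I ⊔ cycIdeal k n ↔ ofPath k n p ∈ I := by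
  rw [eq_geodesicPath p, ← not_iff_not, ← le_repKer_iff, ← le_repKer_iff, sup_le_iff,
    and_iff_left (cycIdeal_le_repKer k _ _)]

theorem le_sup_cycIdeal_iff :
    I ≤ J ⊔ cycIdeal k n ↔ ∀ p, ofPath k n p ∈ I → ofPath k n p ∈ J :=
  ⟨fun h _ hp => ofPath_mem_sup_cycIdeal_iff.1 (h hp), fun h =>
    le_of_forall_ofPath_mem k le_sup_right fun p hp => le_sup_left (a := J) (h p hp)⟩

theorem sup_cycIdeal_eq_iff : I ⊔ cycIdeal k n = J ⊔ cycIdeal k n ↔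
    (I : Set (PiA k n)) ∩ Set.range (ofPath k n) =
      (J : Set (PiA k n)) ∩ Set.range (ofPath k n) := by
  have sup_le_sup_iff (I J : TwoSidedIdeal (PiA k n)) : I ⊔ cycIdeal k n ≤ J ⊔ cycIdeal k n ↔
      (I : Set (PiA k n)) ∩ Set.range (ofPath k n) ⊆ J := by
    rw [sup_le_iff, and_iff_left le_sup_right, le_sup_cycIdeal_iff]
    exact ⟨fun h x ⟨hx, p, hp⟩ => hp ▸ h p (hp ▸ hx), fun h p hp => h ⟨hp, p, rfl⟩⟩
  rw [le_antisymm_iff, sup_le_sup_iff, sup_le_sup_iff, Set.Subset.antisymm_iff,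
    Set.subset_inter_iff, Set.subset_inter_iff, and_iff_left Set.inter_subset_right,
    and_iff_left Set.inter_subset_right]

theorem ofPath_mem_span_iff {S : UpperSet (PathsA n)} {p : PathsA n} :
    ofPath k n p ∈ TwoSidedIdeal.span (ofPath k n '' S) ↔ p ∈ S := by
  refine ⟨fun h => ?_, fun h => TwoSidedIdeal.subset_span ⟨p, h, rfl⟩⟩
  by_contra hp
  rw [eq_geodesicPath p] at h hp
  refine (le_repKer_iff k _ _).1 (TwoSidedIdeal.span_le.2 ?_) h
  rintro _ ⟨q, hq, rfl⟩
  exact (ofPath_mem_repKer_iff k _ _).2 fun hle => hp (S.upper hle hq)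

theorem brickRadical_eq_sup_cycIdeal : brickRadical I = I ⊔ cycIdeal k n := by
  refine le_antisymm (le_sup_cycIdeal_iff.2 fun p hp => ?_) ?_
  · by_contra hI
    rw [eq_geodesicPath p] at hp hI
    have hann := le_brickRadical_iff.1 le_rfl _ (Uniserial.isBrick k p.source p.target)
      (Uniserial.annihilatedBy_iff.2 hI)
    exact Uniserial.annihilatedBy_iff.1 hann hp
  · rw [cycIdeal_eq_span_central]
    exact sup_span_singleton_le_brickRadical (central_mem_center k n) (isNilpotent_central k n) I

variable (k n) in
theorem brickIdeal_eq_cycIdeal : brickIdeal (PiA k n) = cycIdeal k n := by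
  rw [← brickRadical_bot, brickRadical_eq_sup_cycIdeal, bot_sup_eq]

theorem eta_sup_cycIdeal : eta (I ⊔ cycIdeal k n) = eta I := by
  rw [cycIdeal_eq_span_central]
  exact eta_sup_span_singleton (central_mem_center k n) (isNilpotent_central k n) I

theorem eta_le_eta_iff_le_sup_cycIdeal : eta I ≤ eta J ↔ I ≤ J ⊔ cycIdeal k n :=
  ⟨fun h => (le_brickRadical_of_eta_le h).trans_eq brickRadical_eq_sup_cycIdeal,
    fun h => (eta_mono h).trans_eq eta_sup_cycIdeal⟩

theorem eta_eq_eta_iff_sup_cycIdeal_eq :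
    eta I = eta J ↔ I ⊔ cycIdeal k n = J ⊔ cycIdeal k n := by
  rw [le_antisymm_iff, le_antisymm_iff, eta_le_eta_iff_le_sup_cycIdeal,
    eta_le_eta_iff_le_sup_cycIdeal, sup_le_iff, sup_le_iff, and_iff_left le_sup_right,
    and_iff_left le_sup_right]

end

/-! ### Ideals modulo the 2-cycles -/

section Bar

variable {k : Type u} [Field k] {n : ℕ}

instance instRingHomSurjectiveToBar : RingHomSurjective (toBar k n) :=
  ⟨RingCon.mk'_surjective _⟩

theorem toBar_eq_toBar_iff {x y : PiA k n} : toBar k n x = toBar k n y ↔ x - y ∈ cycIdeal k n :=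
  (RingCon.eq _).trans (TwoSidedIdeal.rel_iff ..)

variable (k n) in
theorem ker_toBar : TwoSidedIdeal.ker (R := PiA k n) (S := PiABar k n) (toBar k n) = cycIdeal k n :=
  TwoSidedIdeal.ker_ringCon_mk' _

/-- The preimage in `Π` of an ideal of `Π / I_cyc`. -/
noncomputable def pullback (I : TwoSidedIdeal (PiABar k n)) : TwoSidedIdeal (PiA k n) :=
  I.comap (toBar k n)

theorem mem_pullback {I : TwoSidedIdeal (PiABar k n)} {x : PiA k n} :
    x ∈ pullback I ↔ toBar k n x ∈ I := Iff.rfl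

theorem pullback_map (I : TwoSidedIdeal (PiA k n)) :
    pullback (I.map (toBar k n)) = I ⊔ cycIdeal k n := by
  have h := comap_map_eq_sup_ker (A := PiA k n) (B := PiABar k n) (toBar k n) I
  exact h.trans (congrArg (I ⊔ ·) (ker_toBar k n))

theorem pullback_le_pullback_iff {I J : TwoSidedIdeal (PiABar k n)} :
    pullback I ≤ pullback J ↔ I ≤ J := by
  refine ⟨fun h x hx => ?_, fun h _ hx => h hx⟩
  obtain ⟨x, rfl⟩ := (toBar k n).surjective x
  exact h hx

theorem cycIdeal_le_pullback (I : TwoSidedIdeal (PiABar k n)) : cycIdeal k n ≤ pullback I :=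
  fun x hx => by
    have hx0 : toBar k n x = toBar k n 0 := toBar_eq_toBar_iff.2 ((sub_zero x).symm ▸ hx)
    rw [mem_pullback, hx0, map_zero]
    exact I.zero_mem

theorem pullback_sup_cycIdeal (I : TwoSidedIdeal (PiABar k n)) :
    pullback I ⊔ cycIdeal k n = pullback I :=
  sup_eq_left.2 (cycIdeal_le_pullback I)

theorem eta_pullback_rel_iff {I : TwoSidedIdeal (PiABar k n)} {T U : TorsionClass (PiA k n)} :
    (eta (pullback I)).r T U ↔ (eta I).r (T.restrict (toBar k n)) (U.restrict (toBar k n)) := by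
  have h := eta_comap_rel_iff (A := PiA k n) (B := PiABar k n) (toBar k n) (I := I)
    (T := T) (U := U)
  exact h

theorem eta_pullback_le_eta_pullback_iff {I J : TwoSidedIdeal (PiABar k n)} :
    eta (pullback I) ≤ eta (pullback J) ↔ eta I ≤ eta J := by
  have h := eta_comap_le_eta_comap_iff (A := PiA k n) (B := PiABar k n) (toBar k n) (I := I)
    (J := J)
  exact h

theorem eta_map_toBar_eq_iff {I J : TwoSidedIdeal (PiA k n)} :
    eta (I.map (toBar k n)) = eta (J.map (toBar k n)) ↔ eta I = eta J := by
  rw [le_antisymm_iff, le_antisymm_iff, ← eta_pullback_le_eta_pullback_iff,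
    ← eta_pullback_le_eta_pullback_iff, pullback_map, pullback_map, eta_sup_cycIdeal,
    eta_sup_cycIdeal]

variable (k n) in
/-- The ideals of `Π / I_cyc` correspond to the algebraic congruences of `Π`. -/
noncomputable def algConOrderIso : TwoSidedIdeal (PiABar k n) ≃o AlgCon (PiA k n) :=
  RelIso.ofSurjective
    (OrderEmbedding.ofMapLEIff
      (fun I => (⟨eta (pullback I), _, rfl⟩ : AlgCon (PiA k n))) fun I J => by
        change eta (pullback I) ≤ eta (pullback J) ↔ I ≤ J
        rw [eta_le_eta_iff_le_sup_cycIdeal, pullback_sup_cycIdeal, pullback_le_pullback_iff])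
    (by
      rintro ⟨_, I, rfl⟩
      exact ⟨I.map (toBar k n), Subtype.ext
        ((congrArg eta (pullback_map I)).trans eta_sup_cycIdeal)⟩)

variable (k n) in
/-- The torsion classes of `Π` correspond to those of `Π / I_cyc`. -/
noncomputable def torsionClassOrderIso : TorsionClass (PiA k n) ≃o TorsionClass (PiABar k n) :=
  TorsionClass.restrictOrderIso (toBar k n) (central_mem_center k n) (isNilpotent_central k n)
    ((ker_toBar k n).trans (cycIdeal_eq_span_central k n))

/-- The non-revisiting paths that lie in an ideal of `Π / I_cyc`. -/
def pathsIn (I : TwoSidedIdeal (PiABar k n)) : UpperSet (PathsA n) where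
  carrier := {p | toBar k n (ofPath k n p) ∈ I}
  upper' _ _ h hp := mem_pullback.1 (ofPath_mem_of_le k h (mem_pullback.2 hp))

theorem mem_pathsIn {I : TwoSidedIdeal (PiABar k n)} {p : PathsA n} :
    p ∈ pathsIn I ↔ ofPath k n p ∈ pullback I := Iff.rfl

theorem pathsIn_le_pathsIn_iff {I J : TwoSidedIdeal (PiABar k n)} :
    pathsIn J ≤ pathsIn I ↔ I ≤ J := by
  rw [← pullback_le_pullback_iff, ← pullback_sup_cycIdeal J, le_sup_cycIdeal_iff]
  rfl

theorem pathsIn_map_span (S : UpperSet (PathsA n)) :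
    pathsIn ((TwoSidedIdeal.span (ofPath k n '' S)).map (toBar k n)) = S := by
  refine SetLike.ext fun p => ?_
  rw [mem_pathsIn, pullback_map, ofPath_mem_sup_cycIdeal_iff, ofPath_mem_span_iff]

variable (k n) in
/-- The ideals of `Π / I_cyc` correspond to the upper sets of non-revisiting paths. -/
noncomputable def pathsInOrderIso : TwoSidedIdeal (PiABar k n) ≃o (UpperSet (PathsA n))ᵒᵈ :=
  RelIso.ofSurjective
    (OrderEmbedding.ofMapLEIff (fun I => OrderDual.toDual (pathsIn I)) fun _ _ =>
      pathsIn_le_pathsIn_iff)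
    fun S => ⟨_, congrArg OrderDual.toDual (pathsIn_map_span (OrderDual.ofDual S))⟩

theorem exists_toBar_vertex_mul_mul_vertex_eq {I : TwoSidedIdeal (PiABar k n)} {x : PiA k n}
    (hx : x ∈ pullback I) (i j : Symmetrify (TypeA n)) :
    ∃ r : k, toBar k n (vertex k i * x * vertex k j) =
        r • toBar k n (ofPath k n (geodesicPath i j)) ∧
      (r ≠ 0 → geodesicPath i j ∈ pathsIn I) := by
  have hcorner : vertex k i * x * vertex k j ∈ pullback I :=
    (pullback I).mul_mem_right _ _ ((pullback I).mul_mem_left _ _ hx)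
  obtain ⟨q, hq⟩ := exists_vertex_mul_mul_vertex_eq k i j x
  rw [hq] at hcorner ⊢
  exact ⟨q.coeff 0, toBar_eq_toBar_iff.2 (word_mul_aeval_sub_smul_mem_cycIdeal k _ q),
    fun hq0 => word_mem_of_word_mul_aeval_mem k hq0 hcorner⟩

theorem coe_eq_span_pathsIn (I : TwoSidedIdeal (PiABar k n)) :
    (I : Set (PiABar k n)) =
      Submodule.span k ((fun p => toBar k n (ofPath k n p)) '' (pathsIn I : Set (PathsA n))) := by
  refine Set.Subset.antisymm (fun x hx => ?_) fun x hx => ?_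
  · obtain ⟨x, rfl⟩ := (toBar k n).surjective x
    rw [← sum_vertex_mul_mul_vertex k x]
    simp only [map_sum]
    refine Submodule.sum_mem _ fun i _ => Submodule.sum_mem _ fun j _ => ?_
    obtain ⟨r, hr, hmem⟩ := exists_toBar_vertex_mul_mul_vertex_eq hx i j
    rw [hr]
    obtain rfl | hr0 := eq_or_ne r 0
    · rw [zero_smul]
      exact Submodule.zero_mem _
    · exact Submodule.smul_mem _ _ (Submodule.subset_span ⟨_, hmem hr0, rfl⟩)
  · induction hx using Submodule.span_induction with
    | mem x h =>
      obtain ⟨p, hp, rfl⟩ := h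
      exact hp
    | zero => exact I.zero_mem
    | add x y _ _ hx hy => exact I.add_mem hx hy
    | smul r x _ hx =>
      rw [Algebra.smul_def]
      exact I.mul_mem_left _ _ hx

theorem coe_pathsInOrderIso_symm (S : UpperSet (PathsA n)) :
    ((pathsInOrderIso k n).symm (OrderDual.toDual S) : Set (PiABar k n)) =
      Submodule.span k ((fun p => toBar k n (ofPath k n p)) '' (S : Set (PathsA n))) := by
  have h : pathsIn ((pathsInOrderIso k n).symm (OrderDual.toDual S)) = S :=
    congrArg OrderDual.ofDual ((pathsInOrderIso k n).apply_symm_apply (OrderDual.toDual S))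
  rw [coe_eq_span_pathsIn, h]

end Bar

end PiA

theorem mainTheorem10 (k : Type u) [Field k] (n : ℕ) (hn : 1 ≤ n) :
    -- (a)
    brickIdeal (PiA k n) = PiA.cycIdeal k n ∧
    -- (b), first isomorphism: `UpperSet` is ordered by reverse inclusion, its dual by inclusion
    (∃ Ψ : (UpperSet (PathsA n))ᵒᵈ ≃o TwoSidedIdeal (PiABar k n),
      ∀ S : UpperSet (PathsA n),
        (Ψ (OrderDual.toDual S) : Set (PiABar k n)) =
          Submodule.span k
            ((fun p => PiA.toBar k n (PiA.ofPath k n p)) '' (S : Set (PathsA n)))) ∧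
    -- (b), second isomorphism, through the identification `ρ` of `tors Π` with `tors (Π / I_cyc)`
    (∃ ρ : TorsionClass (PiA k n) ≃o TorsionClass (PiABar k n),
      (∀ T, ρ T = T.restrict (PiA.toBar k n)) ∧
      ∃ Φ : TwoSidedIdeal (PiABar k n) ≃o AlgCon (PiA k n),
        ∀ (I : TwoSidedIdeal (PiABar k n)) (T U : TorsionClass (PiA k n)),
          (Φ I).1.r T U ↔ (eta I).r (ρ T) (ρ U)) ∧
    -- (c)
    (∀ I J : TwoSidedIdeal (PiA k n),
      List.TFAE [
        eta I = eta J,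
        eta (I.map (PiA.toBar k n)) = eta (J.map (PiA.toBar k n)),
        I ⊔ PiA.cycIdeal k n = J ⊔ PiA.cycIdeal k n,
        (I : Set (PiA k n)) ∩ Set.range (PiA.ofPath k n) =
          (J : Set (PiA k n)) ∩ Set.range (PiA.ofPath k n)]) := by
  refine ⟨PiA.brickIdeal_eq_cycIdeal k n,
    ⟨(PiA.pathsInOrderIso k n).symm, PiA.coe_pathsInOrderIso_symm⟩,
    ⟨PiA.torsionClassOrderIso k n, fun _ => rfl, PiA.algConOrderIso k n,
      fun _ _ _ => PiA.eta_pullback_rel_iff⟩, fun I J => ?_⟩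
  tfae_have 1 ↔ 3 := PiA.eta_eq_eta_iff_sup_cycIdeal_eq
  tfae_have 2 ↔ 1 := PiA.eta_map_toBar_eq_iff
  tfae_have 3 ↔ 4 := PiA.sup_cycIdeal_eq_iff
  tfae_finish
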